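/- Let $d\ge 1$ and $R=\mathbb Z^d$ with the metric $\|r-s\|_\infty$. Fix a strict total order on $R$, let $\Gamma_R$ be the set of finite subsets of $R$, and on $\ell^2(\Gamma_R)$ (the antisymmetric Fock space over $\ell^2(R)$) let $b_r$ be the Fermi annihilation operators $$(b_rF)(\sigma)=\mathbf 1_{r\notin\sigma}\,(-1)^{\#\{s\in\sigma:\,s>r\}}\,F(\sigma\cup\{r\}).$$ Let $\mathcal A=CAR(R)$ be the norm closure of the unital $*$-algebra $\mathcal A_0$ generated by all the $b_r$, and, for $S\subset R$, let $\mathcal A_S$ be the unital $*$-algebra generated by $\{b_s:s\in S\}$. Let $(\alpha_{r,s})_{r,s\in R}$ be complex amplitudes and $(h_r)_{r\in R}$ real energies. With $t_{r,s}=\alpha_{r,s}b_s^*b_r$, put $$\tau_{r,s}(a)=-\tfrac12\big(t_{r,s}^*[t_{r,s},a]+[a,t_{r,s}^*]t_{r,s}\big),\qquad \delta_r(a)=i\,h_r[b_r^*b_r,a].$$ Suppose that (I) there is an integer $D\ge 1$ with $\alpha_{r,s}=0$ whenever $\|r-s\|_\infty>D$. Then $\{s:\alpha_{r,s}\ne0\text{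 or }\alpha_{s,r}\neq0\}$ is finite for every $r$ (finite valency), and the Lindbladian $\mathcal L=\sum_{r}\delta_r+\sum_{r,s}\tau_{r,s}$ is a well-defined operator on $\mathcal A$ with domain $\mathcal A_0$ (for each $a\in\mathcal A_0$ only finitely many terms are nonzero). Suppose moreover that (II) there is $K\ge 0$ with $$|\alpha_{r,s}|^2\le K\,\big(\max\{\|r\|_\infty,\|s\|_\infty\}\big)^{2-d}\qquad\text{for all }(r,s)\ne(0,0).$$ Then $\mathcal L$ is a pregenerator of a contractive $C_0$-semigroup on $\mathcal A$: it is closable, and its closure is the generator of such a semigroup. Moreover $\mathcal L$ is dissipative, and, with $R_n=\{r:\|r\|_\infty\le nD\}$ and $\mathcal L^{n,0}(a)=\sum_r\delta_r(a)+\sum_{r,s\in R_n}\tau_{r,s}(a)$, for all $n\ge 1$ and $a\in\mathcal A_{R_n}$ one has $\mathcal L^{n,0}(a)\in\mathcal A_{R_n}$, $\mathcal L(a)\in\mathcal A_{R_{n+1}}$ and $$\|\mathcal L(a)-\mathcal L^{n,0}(a)\|\le M\,n\,\|a\|,\qquad M=8Kd\,(1+\delta_{1,d})\,D^{3-d}(1+2D)^{2d-1},$$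 where $\delta_{1,d}$ is $1$ if $d=1$ and $0$ otherwise. Under (I), if $d\in\{1,2\}$ and the amplitudes are uniformly bounded, then (II) holds for some $K\ge0$. -/

import Mathlib

open Filter Topology
open scoped NNReal

noncomputable section

/-! ### Fermi Fock space over a set of sites, and its annihilation and creation operators -/

namespace QuantumExclusion

section Fock

variable {R : Type*}

/-- The antisymmetric Fock space over `ℓ²(R)`, realised as `ℓ²(Γ_R)`, where `Γ_R` is the set of
finite subsets of `R`. -/
abbrev Fock (R : Type*) : Type _ := lp (fun _ : Finset R => ℂ) 2

open Classical in
/-- The sign `ε(σ, r) = (-1) ^ #{s ∈ σ : s > r}`, for a total order `lt` on the sites. -/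
def sgn (lt : R → R → Prop) (σ : Finset R) (r : R) : ℂ :=
  (-1) ^ (σ.filter (fun s => lt r s)).card

lemma norm_sgn (lt : R → R → Prop) (σ : Finset R) (r : R) : ‖sgn lt σ r‖ = 1 := by
  simp [sgn]

lemma star_sgn (lt : R → R → Prop) (σ : Finset R) (r : R) :
    (starRingEnd ℂ) (sgn lt σ r) = sgn lt σ r := by
  simp [sgn]

lemma memlp_of_perm {ι : Type*} (F : lp (fun _ : ι => ℂ) 2) (e : Equiv.Perm ι) (g : ι → ℂ)
    (hg : ∀ i, ‖g i‖ ≤ ‖F (e i)‖) : Memℓp g 2 := by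
  have h0 : (0 : ℝ) < (2 : ENNReal).toReal := by norm_num
  have hF := (e.summable_iff (f := fun i => ‖F i‖ ^ (2 : ENNReal).toReal)).2
    ((memℓp_gen_iff h0).1 (lp.memℓp F))
  refine (memℓp_gen_iff h0).2 (Summable.of_nonneg_of_le (fun i => by positivity) (fun i => ?_) hF)
  exact Real.rpow_le_rpow (norm_nonneg _) (hg i) h0.le

lemma norm_le_of_perm {ι : Type*} (F G : lp (fun _ : ι => ℂ) 2) (e : Equiv.Perm ι)
    (hg : ∀ i, ‖G i‖ ≤ ‖F (e i)‖) : ‖G‖ ≤ ‖F‖ := by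
  have h0 : (0 : ℝ) < (2 : ENNReal).toReal := by norm_num
  have hF0 := (memℓp_gen_iff h0).1 (lp.memℓp F)
  have hF := (e.summable_iff (f := fun i => ‖F i‖ ^ (2 : ENNReal).toReal)).2 hF0
  have hG := (memℓp_gen_iff h0).1 (lp.memℓp G)
  rw [lp.norm_eq_tsum_rpow h0, lp.norm_eq_tsum_rpow h0]
  refine Real.rpow_le_rpow (tsum_nonneg fun i => by positivity) ?_ (by positivity)
  rw [← e.tsum_eq (fun i => ‖F i‖ ^ (2 : ENNReal).toReal)]
  exact hG.tsum_le_tsum (fun i => Real.rpow_le_rpow (norm_nonneg _) (hg i) h0.le) hF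

open Classical in
/-- The involution of `Γ_R` that adds the site `r` if it is absent and removes it otherwise. -/
def toggle (r : R) : Equiv.Perm (Finset R) where
  toFun σ := if r ∈ σ then σ.erase r else insert r σ
  invFun σ := if r ∈ σ then σ.erase r else insert r σ
  left_inv σ := by
    by_cases h : r ∈ σ <;> simp [h]
  right_inv σ := by
    by_cases h : r ∈ σ <;> simp [h]

open Classical in
/-- The values of `b_r F`. -/
def annFun (lt : R → R → Prop) (r : R) (F : Finset R → ℂ) (σ : Finset R) : ℂ :=
  if r ∈ σ then 0 else sgn lt σ r * F (insert r σ)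

open Classical in
/-- The values of `b_r^* F`. -/
def creFun (lt : R → R → Prop) (r : R) (F : Finset R → ℂ) (σ : Finset R) : ℂ :=
  if r ∈ σ then sgn lt σ r * F (σ.erase r) else 0

lemma norm_annFun_le (lt : R → R → Prop) (r : R) (F : Finset R → ℂ) (σ : Finset R) :
    ‖annFun lt r F σ‖ ≤ ‖F (toggle r σ)‖ := by
  by_cases h : r ∈ σ <;> simp [annFun, toggle, h, norm_sgn]

lemma norm_creFun_le (lt : R → R → Prop) (r : R) (F : Finset R → ℂ) (σ : Finset R) :
    ‖creFun lt r F σ‖ ≤ ‖F (toggle r σ)‖ := by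
  by_cases h : r ∈ σ <;> simp [creFun, toggle, h, norm_sgn]

/-- The Fermi annihilation operator `b_r` on Fock space. -/
def annOp (lt : R → R → Prop) (r : R) : Fock R →L[ℂ] Fock R :=
  LinearMap.mkContinuous
    { toFun := fun F => ⟨annFun lt r F, memlp_of_perm F (toggle r) _ (norm_annFun_le lt r F)⟩
      map_add' := fun F G => by
        ext σ
        change annFun lt r (⇑(F + G)) σ = annFun lt r F σ + annFun lt r G σ
        by_cases h : r ∈ σ <;> simp [annFun, h, mul_add]
      map_smul' := fun c F => by
        ext σ
        by_cases h : r ∈ σ <;> simp [annFun, h]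
        ring }
    1 (fun F => by
      rw [one_mul]
      exact norm_le_of_perm F _ (toggle r) (norm_annFun_le lt r F))

/-- The Fermi creation operator on Fock space. -/
def creOp (lt : R → R → Prop) (r : R) : Fock R →L[ℂ] Fock R :=
  LinearMap.mkContinuous
    { toFun := fun F => ⟨creFun lt r F, memlp_of_perm F (toggle r) _ (norm_creFun_le lt r F)⟩
      map_add' := fun F G => by
        ext σ
        change creFun lt r (⇑(F + G)) σ = creFun lt r F σ + creFun lt r G σ
        by_cases h : r ∈ σ <;> simp [creFun, h, mul_add]
      map_smul' := fun c F => by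
        ext σ
        by_cases h : r ∈ σ <;> simp [creFun, h]
        ring }
    1 (fun F => by
      rw [one_mul]
      exact norm_le_of_perm F _ (toggle r) (norm_creFun_le lt r F))

lemma annOp_apply (lt : R → R → Prop) (r : R) (F : Fock R) (σ : Finset R) :
    annOp lt r F σ = annFun lt r F σ := rfl

lemma creOp_apply (lt : R → R → Prop) (r : R) (F : Fock R) (σ : Finset R) :
    creOp lt r F σ = creFun lt r F σ := rfl

open Classical in
lemma sgn_insert (lt : R → R → Prop) {σ : Finset R} {s : R} (hs : s ∉ σ) (r : R) :
    sgn lt (insert s σ) r = (if lt r s then -1 else 1) * sgn lt σ r := by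
  unfold sgn
  by_cases h : lt r s
  · rw [Finset.filter_insert, if_pos h, if_pos h, Finset.card_insert_of_notMem (by simp [hs]),
      pow_succ]
    ring
  · rw [Finset.filter_insert, if_neg h, if_neg h, one_mul]

/-- The creation operator is the adjoint of the annihilation operator. -/
lemma star_annOp (lt : R → R → Prop) [IsStrictTotalOrder R lt] (r : R) :
    star (annOp lt r) = creOp lt r := by
  classical
  rw [ContinuousLinearMap.star_eq_adjoint, eq_comm, ContinuousLinearMap.eq_adjoint_iff]
  intro F G
  rw [lp.inner_eq_tsum, lp.inner_eq_tsum, ← (toggle r).tsum_eq]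
  refine tsum_congr fun σ => ?_
  simp only [creOp_apply, annOp_apply, RCLike.inner_apply]
  by_cases h : r ∈ σ
  · simp [toggle, creFun, annFun, h]
  · have := sgn_insert lt h r
    rw [if_neg (irrefl r), one_mul] at this
    simp [toggle, creFun, annFun, h, star_sgn, this]
    ring

/-- `b_r b_s + b_s b_r = 0` for distinct sites. -/
lemma annOp_anticomm (lt : R → R → Prop) [IsStrictTotalOrder R lt] {r s : R} (hrs : r ≠ s) :
    annOp lt r * annOp lt s = -(annOp lt s * annOp lt r) := by
  classical
  ext F σ
  simp only [mul_apply_eq_comp, neg_apply, lp.coeFn_neg,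
    Pi.neg_apply, annOp_apply, annFun, Finset.mem_insert]
  by_cases hr : r ∈ σ
  · simp [hr]
  by_cases hs : s ∈ σ
  · simp [hs]
  simp only [hr, hs, hrs, hrs.symm, or_self, if_false, sgn_insert lt hr, sgn_insert lt hs,
    Finset.insert_comm r s]
  rcases trichotomous_of lt r s with h | h | h
  · simp [h, asymm_of lt h]; ring
  · exact absurd h hrs
  · simp [h, asymm_of lt h]; ring

/-- `b_r b_s^* + b_s^* b_r = 0` for distinct sites. -/
lemma annOp_creOp_anticomm (lt : R → R → Prop) [IsStrictTotalOrder R lt] {r s : R}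
    (hrs : r ≠ s) : annOp lt r * creOp lt s = -(creOp lt s * annOp lt r) := by
  classical
  ext F σ
  simp only [mul_apply_eq_comp, neg_apply, lp.coeFn_neg,
    Pi.neg_apply, annOp_apply, creOp_apply, annFun, creFun, Finset.mem_insert, Finset.mem_erase]
  by_cases hr : r ∈ σ
  · simp [hr, hrs]
  by_cases hs : s ∈ σ
  · obtain ⟨ρ, hρ, rfl⟩ : ∃ ρ : Finset R, s ∉ ρ ∧ insert s ρ = σ :=
      ⟨σ.erase s, by simp, Finset.insert_erase hs⟩
    have h1 : (insert r (insert s ρ)).erase s = insert r ρ := by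
      rw [Finset.insert_comm, Finset.erase_insert]
      simp [hρ, hrs.symm]
    simp only [hr, hs, if_true, if_false, or_true, Finset.erase_insert hρ, and_false,
      sgn_insert lt hr, sgn_insert lt hρ, h1]
    rcases trichotomous_of lt r s with h | h | h
    · simp [h, asymm_of lt h, irrefl_of lt s]; ring
    · exact absurd h hrs
    · simp [h, asymm_of lt h, irrefl_of lt s]; ring
  · simp [hs, hrs.symm]

/-! ### The CAR algebra in its Fock representation -/

/-- The CAR algebra over `R` in its Fock representation: the norm closure of the unital
`*`-algebra of operators on Fock space generated by the annihilation operators. -/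
abbrev CAR (lt : R → R → Prop) : Type _ :=
  ↥((StarAlgebra.adjoin ℂ (Set.range (annOp lt))).topologicalClosure)

/-- The annihilation operator `b_r`, as an element of the CAR algebra. -/
def ann (lt : R → R → Prop) (r : R) : CAR lt :=
  ⟨annOp lt r, StarSubalgebra.le_topologicalClosure _
    (StarAlgebra.subset_adjoin ℂ _ (Set.mem_range_self r))⟩

/-- The unital `*`-algebra `𝒜_S` generated by the `b_s` with `s ∈ S`. -/
def localAlg (lt : R → R → Prop) (S : Set R) : StarSubalgebra ℂ (CAR lt) :=
  StarAlgebra.adjoin ℂ (ann lt '' S)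

/-- The dense `*`-subalgebra `𝒜₀` generated by all of the `b_r`. -/
def A₀ (lt : R → R → Prop) : StarSubalgebra ℂ (CAR lt) := localAlg lt Set.univ

lemma ann_anticomm (lt : R → R → Prop) [IsStrictTotalOrder R lt] {r s : R} (hrs : r ≠ s) :
    ann lt r * ann lt s = -(ann lt s * ann lt r) :=
  Subtype.ext (annOp_anticomm lt hrs)

lemma ann_star_anticomm (lt : R → R → Prop) [IsStrictTotalOrder R lt] {r s : R} (hrs : r ≠ s) :
    ann lt r * star (ann lt s) = -(star (ann lt s) * ann lt r) := by
  apply Subtype.ext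
  change annOp lt r * star (annOp lt s) = -(star (annOp lt s) * annOp lt r)
  rw [star_annOp]
  exact annOp_creOp_anticomm lt hrs

/-- `b_s^* b_r` commutes with `b_u` if `u` is neither `r` nor `s`. -/
lemma hop_comm_ann (lt : R → R → Prop) [IsStrictTotalOrder R lt] {r s u : R}
    (hr : u ≠ r) (hs : u ≠ s) :
    star (ann lt s) * ann lt r * ann lt u = ann lt u * (star (ann lt s) * ann lt r) := by
  rw [mul_assoc, ann_anticomm lt hr.symm, mul_neg, ← mul_assoc, ← mul_assoc,
    ann_star_anticomm lt hs, neg_mul]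

lemma hop_comm_local (lt : R → R → Prop) [IsStrictTotalOrder R lt] {S : Set R} {r s : R}
    (hr : r ∉ S) (hs : s ∉ S) {a : CAR lt} (ha : a ∈ localAlg lt S) :
    star (ann lt s) * ann lt r * a = a * (star (ann lt s) * ann lt r) := by
  have key : localAlg lt S ≤ StarSubalgebra.centralizer ℂ {star (ann lt s) * ann lt r} := by
    refine StarAlgebra.adjoin_le ?_
    rintro _ ⟨u, hu, rfl⟩
    have h1 : u ≠ r := fun h => hr (h ▸ hu)
    have h2 : u ≠ s := fun h => hs (h ▸ hu)
    rw [SetLike.mem_coe, StarSubalgebra.mem_centralizer_iff]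
    rintro g rfl
    refine ⟨hop_comm_ann lt h1 h2, ?_⟩
    rw [star_mul, star_star]
    exact hop_comm_ann lt h2 h1
  exact ((StarSubalgebra.mem_centralizer_iff ℂ).1 (key ha) _ rfl).1

lemma localAlg_mono (lt : R → R → Prop) {S T : Set R} (h : S ⊆ T) :
    localAlg lt S ≤ localAlg lt T :=
  StarAlgebra.adjoin_mono (Set.image_mono h)

/-- `𝒜₀` is the union of the algebras `𝒜_S` with `S` finite. -/
lemma exists_finite_of_mem_A₀ (lt : R → R → Prop) {a : CAR lt} (ha : a ∈ A₀ lt) :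
    ∃ S : Set R, S.Finite ∧ a ∈ localAlg lt S := by
  unfold A₀ localAlg at ha
  induction ha using StarAlgebra.adjoin_induction with
  | mem x hx =>
    obtain ⟨r, -, rfl⟩ := hx
    exact ⟨{r}, Set.finite_singleton r,
      StarAlgebra.subset_adjoin ℂ _ (Set.mem_image_of_mem _ rfl)⟩
  | algebraMap c => exact ⟨∅, Set.finite_empty, algebraMap_mem _ c⟩
  | add x y _ _ hx hy =>
    obtain ⟨S, hS, hx⟩ := hx
    obtain ⟨T, hT, hy⟩ := hy
    exact ⟨S ∪ T, hS.union hT, add_mem (localAlg_mono lt Set.subset_union_left hx)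
      (localAlg_mono lt Set.subset_union_right hy)⟩
  | mul x y _ _ hx hy =>
    obtain ⟨S, hS, hx⟩ := hx
    obtain ⟨T, hT, hy⟩ := hy
    exact ⟨S ∪ T, hS.union hT, mul_mem (localAlg_mono lt Set.subset_union_left hx)
      (localAlg_mono lt Set.subset_union_right hy)⟩
  | star x _ hx =>
    obtain ⟨S, hS, hx⟩ := hx
    exact ⟨S, hS, star_mem hx⟩

/-! ### The Lindbladian of the quantum exclusion process -/

/-- The set of sites that interact with the site `r`. -/
def interacting (α : R → R → ℂ) (r : R) : Set R := {s | α r s ≠ 0 ∨ α s r ≠ 0}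

/-- The finite valency condition on a family of amplitudes. -/
def FiniteValency (α : R → R → ℂ) : Prop := ∀ r, (interacting α r).Finite

/-- The transport operator `t_{r,s} = α_{r,s} b_s^* b_r`. -/
def transport (lt : R → R → Prop) (α : R → R → ℂ) (r s : R) : CAR lt :=
  α r s • (star (ann lt s) * ann lt r)

/-- `τ_{r,s}(a) = -½ (t^* [t, a] + [a, t^*] t)`, where `t = t_{r,s}`. -/
def tauTerm (lt : R → R → Prop) (α : R → R → ℂ) (r s : R) : CAR lt →ₗ[ℂ] CAR lt where
  toFun a := -((1 / 2 : ℂ) •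
    (star (transport lt α r s) * (transport lt α r s * a - a * transport lt α r s) +
      (a * star (transport lt α r s) - star (transport lt α r s) * a) * transport lt α r s))
  map_add' a b := by
    rw [← neg_add, ← smul_add]
    congr 2
    noncomm_ring
  map_smul' c a := by
    rw [RingHom.id_apply, smul_neg, smul_comm c]
    congr 2
    simp only [mul_smul_comm, smul_mul_assoc, ← smul_sub, ← smul_add]

/-- `δ_r(a) = i h_r [b_r^* b_r, a]`. -/
def deltaTerm (lt : R → R → Prop) (h : R → ℝ) (r : R) : CAR lt →ₗ[ℂ] CAR lt where
  toFun a := (Complex.I * (h r : ℂ)) •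
    (star (ann lt r) * ann lt r * a - a * (star (ann lt r) * ann lt r))
  map_add' a b := by
    rw [← smul_add]
    congr 1
    noncomm_ring
  map_smul' c a := by
    rw [RingHom.id_apply, smul_comm c]
    congr 1
    simp only [mul_smul_comm, smul_mul_assoc, ← smul_sub]

lemma tauTerm_eq_zero (lt : R → R → Prop) [IsStrictTotalOrder R lt] (α : R → R → ℂ)
    {S : Set R} {r s : R} (h : α r s = 0 ∨ (r ∉ S ∧ s ∉ S)) {a : CAR lt}
    (ha : a ∈ localAlg lt S) : tauTerm lt α r s a = 0 := by
  rcases h with h | ⟨hr, hs⟩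
  · simp [tauTerm, transport, h]
  · have h1 := hop_comm_local lt hr hs ha
    have h2 := hop_comm_local lt hs hr ha
    simp [tauTerm, transport, h1, h2]

lemma deltaTerm_eq_zero (lt : R → R → Prop) [IsStrictTotalOrder R lt] (h : R → ℝ)
    {S : Set R} {r : R} (hr : r ∉ S) {a : CAR lt} (ha : a ∈ localAlg lt S) :
    deltaTerm lt h r a = 0 := by
  simp [deltaTerm, hop_comm_local lt hr hr ha]

lemma finite_support_delta (lt : R → R → Prop) [IsStrictTotalOrder R lt] (h : R → ℝ)
    {a : CAR lt} (ha : a ∈ A₀ lt) : (Function.support fun r => deltaTerm lt h r a).Finite := by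
  obtain ⟨S, hS, haS⟩ := exists_finite_of_mem_A₀ lt ha
  refine hS.subset fun r hr => ?_
  by_contra hrS
  exact hr (deltaTerm_eq_zero lt h hrS haS)

lemma finite_support_tau (lt : R → R → Prop) [IsStrictTotalOrder R lt] {α : R → R → ℂ}
    (hα : FiniteValency α) {a : CAR lt} (ha : a ∈ A₀ lt) :
    (Function.support fun q : R × R => tauTerm lt α q.1 q.2 a).Finite := by
  obtain ⟨S, hS, haS⟩ := exists_finite_of_mem_A₀ lt ha
  have hfin : (S ∪ ⋃ r ∈ S, interacting α r).Finite := hS.union (hS.biUnion fun r _ => hα r)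
  refine (hfin.prod hfin).subset ?_
  rintro ⟨r, s⟩ hq
  have h0 : α r s ≠ 0 := fun h => hq (tauTerm_eq_zero lt α (Or.inl h) haS)
  have h1 : r ∈ S ∨ s ∈ S := by
    by_contra hc
    exact hq (tauTerm_eq_zero lt α (Or.inr (not_or.1 hc)) haS)
  simp only [Set.mem_prod, Set.mem_union, Set.mem_iUnion, exists_prop]
  rcases h1 with h1 | h1
  · exact ⟨Or.inl h1, Or.inr ⟨r, h1, Or.inl h0⟩⟩
  · exact ⟨Or.inr ⟨s, h1, Or.inr h0⟩, Or.inl h1⟩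

/-- The derivation `δ = ∑_r δ_r` on `𝒜₀`; each of the sums has finitely many nonzero terms. -/
def delta (lt : R → R → Prop) [IsStrictTotalOrder R lt] (h : R → ℝ) :
    (A₀ lt).toSubalgebra.toSubmodule →ₗ[ℂ] CAR lt where
  toFun a := ∑ᶠ r, deltaTerm lt h r a
  map_add' a b := by
    simp only [Submodule.coe_add, map_add]
    exact finsum_add_distrib (finite_support_delta lt h a.2) (finite_support_delta lt h b.2)
  map_smul' c a := by
    simp only [Submodule.coe_smul, map_smul, RingHom.id_apply]
    exact (smul_finsum' c (finite_support_delta lt h a.2)).symm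

/-- The map `τ = ∑_{r,s} τ_{r,s}` on `𝒜₀`; each of the sums has finitely many nonzero terms,
because of the finite valency condition. -/
def tau (lt : R → R → Prop) [IsStrictTotalOrder R lt] {α : R → R → ℂ} (hα : FiniteValency α) :
    (A₀ lt).toSubalgebra.toSubmodule →ₗ[ℂ] CAR lt where
  toFun a := ∑ᶠ q : R × R, tauTerm lt α q.1 q.2 a
  map_add' a b := by
    simp only [Submodule.coe_add, map_add]
    exact finsum_add_distrib (finite_support_tau lt hα a.2) (finite_support_tau lt hα b.2)
  map_smul' c a := by
    simp only [Submodule.coe_smul, map_smul, RingHom.id_apply]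
    exact (smul_finsum' c (finite_support_tau lt hα a.2)).symm

/-- The Lindbladian `δ + τ`, an operator on the CAR algebra with domain `𝒜₀`. -/
def lindbladian (lt : R → R → Prop) [IsStrictTotalOrder R lt] {α : R → R → ℂ}
    (hα : FiniteValency α) (h : R → ℝ) : CAR lt →ₗ.[ℂ] CAR lt where
  domain := (A₀ lt).toSubalgebra.toSubmodule
  toFun := delta lt h + tau lt hα

/-- The truncated Lindbladian `a ↦ δ(a) + ∑_{r,s ∈ S} τ_{r,s}(a)`. -/
def truncLindbladian (lt : R → R → Prop) [IsStrictTotalOrder R lt] (α : R → R → ℂ) (h : R → ℝ)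
    (S : Set R) (a : (A₀ lt).toSubalgebra.toSubmodule) : CAR lt :=
  delta lt h a + ∑ᶠ q ∈ S ×ˢ S, tauTerm lt α q.1 q.2 a

end Fock

/-! ### Operators and semigroups on Banach spaces -/

section Semigroup

variable {X : Type*} [NormedAddCommGroup X] [NormedSpace ℂ X]

/-- An operator `L` is dissipative if `λ ‖x‖ ≤ ‖λ x - L x‖` for all `x` in its domain and all
`λ > 0`. -/
def IsDissipative (L : X →ₗ.[ℂ] X) : Prop :=
  ∀ x : L.domain, ∀ c : ℝ, 0 < c → c * ‖(x : X)‖ ≤ ‖(c : ℂ) • (x : X) - L x‖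

/-- A `C₀`-semigroup of bounded operators. -/
structure C0Semigroup (X : Type*) [NormedAddCommGroup X] [NormedSpace ℂ X] where
  toFun : ℝ≥0 → X →L[ℂ] X
  map_zero : toFun 0 = 1
  map_add : ∀ s t, toFun (s + t) = toFun s * toFun t
  tendsto_zero : ∀ x, Tendsto (fun t => toFun t x) (𝓝 0) (𝓝 x)

/-- `G` is the generator of `T`: its domain consists of the `x` for which `t⁻¹ (T_t x - x)`
converges as `t → 0+`, and `G x` is the limit. -/
def IsGenerator (T : C0Semigroup X) (G : X →ₗ.[ℂ] X) : Prop :=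
  ∀ x y : X, (x, y) ∈ G.graph ↔
    Tendsto (fun t : ℝ≥0 => ((t : ℂ)⁻¹) • (T.toFun t x - x)) (𝓝[>] 0) (𝓝 y)

/-- `L` is a pregenerator of `T`: it is closable, and its closure is the generator of `T`. -/
def IsPregenerator (T : C0Semigroup X) (L : X →ₗ.[ℂ] X) : Prop :=
  L.IsClosable ∧ IsGenerator T L.closure

end Semigroup

/-! ### Integer lattices -/

/-- The amplitudes `α` vanish between sites at distance more than `D` (in the `ℓ^∞` metric). -/
def HasRange {d : ℕ} (α : (Fin d → ℤ) → (Fin d → ℤ) → ℂ) (D : ℕ) : Prop :=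
  ∀ r s, (D : ℝ) < ‖r - s‖ → α r s = 0

/-- `|α_{r,s}|² ≤ K max(‖r‖_∞, ‖s‖_∞) ^ (2 - d)` for all `(r, s) ≠ (0, 0)`. -/
def GrowthBound {d : ℕ} (α : (Fin d → ℤ) → (Fin d → ℤ) → ℂ) (K : ℝ) : Prop :=
  ∀ r s, (r, s) ≠ (0, 0) → ‖α r s‖ ^ 2 ≤ K * (max ‖r‖ ‖s‖) ^ ((2 : ℤ) - (d : ℤ))

/-- The cube `R_n = {r ∈ ℤ^d : ‖r‖_∞ ≤ n D}`. -/
def cube (d D n : ℕ) : Set (Fin d → ℤ) := {r | ‖r‖ ≤ (n : ℝ) * D}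

end QuantumExclusion

end

open QuantumExclusion

/-! Let $A_n$ be the Lindbladian of the sites of $R_n$ alone, a bounded operator, and $V_n=\mathcal
A_{R_n}$. The proof rests on three facts, collected in `LocalApprox`. (a) Each $e^{tA_n}$, $t\ge 0$,
is a contraction: because of the Lindblad form, $1+\varepsilon A_n$ is a completely positive map of
norm $1+O(\varepsilon^2)$ up to an error $O(\varepsilon^2)$ (`norm_add_lindblad_le`). (b)
$A_m=\mathcal L$ on $V_n$ for all $m>n$, by finite range. (c) $\|A_{n+1}a-A_na\|\le Mn\|a\|$ on
$V_n$: only hops across the boundary of $R_n$ contribute, there are $O(n^{d-1})$ of them, and (II)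
makes each of size $O(n^{2-d})$ (`norm_finiteLindbladian_box_sub_le`).

Linear growth in $n$ is what iterated Duhamel estimates tolerate. For $a\in V_n$ the residual
$(A_{n+k+1}-A_{n+k})e^{tA_{n+k}}a$ is at most $Mn\binom{n+k}{k}(Mt)^k\|a\|$ (`norm_residual_le`).
For $Mt<1$ this is summable in $k$, so $e^{tA_m}a$ converges as $m\to\infty$; contractivity and
composition extend this to all $a$ and all $t\ge 0$. The limits form a contraction semigroup whose
generator extends $\mathcal L$, which gives dissipativity.

The same residual bound shows that $1-\mathcal L$ has dense range. If $f$ vanishes on the range,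
then $e^{-s}f(e^{sA_m}b)$ is nearly constant on a short interval $[0,\tau]$, whence $|f(b)|\le
e^{-\tau}\|f\|\|b\|$ and $f=0$ (`norm_functional_le`, `functional_eq_zero`). By
`isPregenerator_of_dense_range`, the closure of $\mathcal L$ is then the whole generator. -/

noncomputable section
namespace QuantumExclusion

/-! ### Exponentials of bounded operators: contractivity and Duhamel comparison. -/

section Exponential

variable {X : Type*} [NormedAddCommGroup X] [NormedSpace ℂ X]

/-- The operator `e^{tA}`. -/
def expOp (A : X →L[ℂ] X) (t : ℝ) : X →L[ℂ] X := NormedSpace.exp ((t : ℂ) • A)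

lemma expOp_zero (A : X →L[ℂ] X) : expOp A 0 = 1 := by
  simp [expOp]

lemma expOp_apply_comm (A : X →L[ℂ] X) (t : ℝ) (x : X) :
    A (expOp A t x) = expOp A t (A x) := by
  have h : Commute A (expOp A t) := ((Commute.refl A).smul_right _).exp_right
  exact congrArg (fun B : X →L[ℂ] X => B x) h.eq

lemma norm_apply_le_of_norm_le_one {B : X →L[ℂ] X} (h : ‖B‖ ≤ 1) (x : X) : ‖B x‖ ≤ ‖x‖ := by
  simpa using B.le_of_opNorm_le h x

variable [CompleteSpace X]

lemma expOp_add (A : X →L[ℂ] X) (s t : ℝ) : expOp A (s + t) = expOp A s * expOp A t := by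
  let _ : NormedAlgebra ℚ (X →L[ℂ] X) := NormedAlgebra.restrictScalars ℚ ℂ _
  unfold expOp
  rw [Complex.ofReal_add, add_smul]
  exact NormedSpace.exp_add_of_commute (((Commute.refl A).smul_left _).smul_right _)

lemma expOp_natCast_mul (A : X →L[ℂ] X) (n : ℕ) (t : ℝ) : expOp A (n * t) = expOp A t ^ n := by
  induction n with
  | zero => simp [expOp_zero]
  | succ n ih => rw [pow_succ, ← ih, ← expOp_add]; push_cast; ring_nf

lemma hasDerivAt_expOp_apply (A : X →L[ℂ] X) (x : X) (t : ℝ) :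
    HasDerivAt (fun s : ℝ => expOp A s x) (expOp A t (A x)) t := by
  have h1 : HasDerivAt (fun z : ℂ => NormedSpace.exp (z • A) x)
      (NormedSpace.exp ((t : ℂ) • A) (A x)) (t : ℂ) := by
    simpa using (hasDerivAt_exp_smul_const A (t : ℂ)).clm_apply (hasDerivAt_const (t : ℂ) x)
  simpa using! h1.scomp t Complex.ofRealCLM.hasDerivAt

/-- The partial sums of the exponential series stay in $V$; closedness carries this to the limit. -/
lemma expOp_apply_mem {A : X →L[ℂ] X} {V : Submodule ℂ X} (hV : IsClosed (V : Set X))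
    (h : ∀ v ∈ V, A v ∈ V) (t : ℝ) {v : X} (hv : v ∈ V) : expOp A t v ∈ V := by
  have h1 := NormedSpace.exp_series_hasSum_exp' (𝕂 := ℂ) ((t : ℂ) • A)
  have h2 := h1.mapL (ContinuousLinearMap.apply ℂ X v)
  refine hV.mem_of_tendsto h2 (Eventually.of_forall fun F => V.sum_mem fun n _ => ?_)
  have h3 : ∀ n : ℕ, (((t : ℂ) • A) ^ n) v ∈ V := by
    intro n
    induction n with
    | zero => simpa using hv
    | succ n ih => rw [pow_succ']; exact V.smul_mem _ (h _ ih)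
  simpa using V.smul_mem _ (h3 n)

/-- A bounded operator `A` with `‖1 + εA‖ ≤ 1 + Cε²` generates a contraction semigroup. -/
lemma norm_expOp_le_one {A : X →L[ℂ] X} {C : ℝ}
    (h : ∀ ε : ℝ, 0 ≤ ε → ‖1 + (ε : ℂ) • A‖ ≤ 1 + C * ε ^ 2) {t : ℝ} (ht : 0 ≤ t) :
    ‖expOp A t‖ ≤ 1 := by
  have hd : HasDerivAt (fun s : ℝ => expOp A s) A 0 := by
    have h1 := hasDerivAt_exp_smul_const A (((0 : ℝ) : ℂ))
    simpa using! h1.scomp (0 : ℝ) Complex.ofRealCLM.hasDerivAt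
  -- Write $e^{tA}=(e^{\varepsilon A})^n$ with $\varepsilon=t/n$. For large $n$ the differentiation
  -- error and $C\varepsilon^2$ are each at most $\eta\varepsilon/2$, so the norm is at most
  -- $(1+\eta\varepsilon)^n\le e^{\eta t}$, and $\eta$ is arbitrary.
  have key : ∀ η : ℝ, 0 < η → ‖expOp A t‖ ≤ Real.exp (η * t) := by
    intro η hη
    have h1 : ∀ᶠ ε : ℝ in 𝓝 0, ‖expOp A ε - 1 - (ε : ℂ) • A‖ ≤ η / 2 * ‖ε‖ := by
      have := (hasDerivAt_iff_isLittleO_nhds_zero.1 hd).def (half_pos hη)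
      filter_upwards [this] with ε hε
      simpa [expOp_zero] using hε
    have h2 : ∀ᶠ ε : ℝ in 𝓝 0, C * ε < η / 2 := by
      have : Tendsto (fun ε : ℝ => C * ε) (𝓝 0) (𝓝 (C * 0)) := by
        exact (continuous_const.mul continuous_id).tendsto 0
      rw [mul_zero] at this
      exact this.eventually (gt_mem_nhds (half_pos hη))
    have h3 : Tendsto (fun n : ℕ => t / (n : ℝ)) atTop (𝓝 0) :=
      tendsto_const_div_atTop_nhds_zero_nat t
    obtain ⟨n, ⟨ha, hb⟩, hn⟩ := ((h3.eventually (h1.and h2)).and (eventually_gt_atTop 0)).exists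
    have hn' : (0 : ℝ) < n := by exact_mod_cast hn
    set ε := t / n with hε
    have hε0 : 0 ≤ ε := by positivity
    have h4 : ‖expOp A ε‖ ≤ 1 + η * ε := by
      calc ‖expOp A ε‖ = ‖(expOp A ε - 1 - (ε : ℂ) • A) + (1 + (ε : ℂ) • A)‖ := by
            congr 1; abel
        _ ≤ η / 2 * ‖ε‖ + (1 + C * ε ^ 2) := (norm_add_le _ _).trans (add_le_add ha (h ε hε0))
        _ ≤ 1 + η * ε := by
            rw [Real.norm_of_nonneg hε0]
            nlinarith [mul_le_mul_of_nonneg_right hb.le hε0]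
    have h5 : expOp A t = expOp A ε ^ n := by
      rw [← expOp_natCast_mul, hε]; congr 1; field_simp
    calc ‖expOp A t‖ ≤ ‖expOp A ε‖ ^ n := by rw [h5]; exact norm_pow_le' _ hn
      _ ≤ (Real.exp (η * ε)) ^ n := by
          refine pow_le_pow_left₀ (norm_nonneg _) (h4.trans ?_) n
          rw [add_comm]; exact Real.add_one_le_exp _
      _ = Real.exp (η * t) := by
          rw [← Real.exp_nat_mul, hε]; congr 1; field_simp
  have hlim : Tendsto (fun η : ℝ => Real.exp (η * t)) (𝓝[>] 0) (𝓝 1) := by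
    have : Continuous fun η : ℝ => Real.exp (η * t) := by fun_prop
    simpa using (this.tendsto 0).mono_left nhdsWithin_le_nhds
  exact ge_of_tendsto hlim (eventually_nhdsWithin_of_forall fun η hη => key η hη)

/-- Comparison of two exponentials by means of Duhamel's formula. -/
lemma norm_expOp_sub_expOp_le {A B : X →L[ℂ] X} (hA : ∀ t : ℝ, 0 ≤ t → ‖expOp A t‖ ≤ 1)
    {x : X} {c t : ℝ} (k : ℕ) (ht : 0 ≤ t)
    (h : ∀ s ∈ Set.Icc 0 t, ‖A (expOp B s x) - B (expOp B s x)‖ ≤ c * s ^ k) :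
    ‖expOp A t x - expOp B t x‖ ≤ c * (t ^ (k + 1) / (k + 1)) := by
  -- The Duhamel path $e^{(t-s)A}e^{sB}x$ is subtracted from its value at $s=0$: the result vanishes
  -- at $s=0$ and is the required difference at $s=t$.
  have hd : ∀ s : ℝ, HasDerivAt (fun s : ℝ => expOp A t x - expOp A (t - s) (expOp B s x))
      (expOp A (t - s) (A (expOp B s x) - B (expOp B s x))) s := by
    intro s
    have h1 : HasDerivAt (fun z : ℂ => NormedSpace.exp (((t : ℂ) - z) • A))
        (-(NormedSpace.exp (((t : ℂ) - s) • A) * A)) (s : ℂ) := by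
      have := (hasDerivAt_exp_smul_const A ((t : ℂ) - s)).scomp (s : ℂ)
        ((hasDerivAt_id (s : ℂ)).const_sub (t : ℂ))
      simpa using! this
    have h2 : HasDerivAt (fun z : ℂ => NormedSpace.exp (z • B) x)
        (NormedSpace.exp ((s : ℂ) • B) (B x)) (s : ℂ) := by
      simpa using (hasDerivAt_exp_smul_const B (s : ℂ)).clm_apply (hasDerivAt_const (s : ℂ) x)
    have h3 := ((h1.clm_apply h2).scomp s Complex.ofRealCLM.hasDerivAt).const_sub (expOp A t x)
    have h4 : NormedSpace.exp ((s : ℂ) • B) (B x) = B (NormedSpace.exp ((s : ℂ) • B) x) :=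
      (expOp_apply_comm B s x).symm
    rw [h4] at h3
    convert! h3 using 1
    · funext r; simp [expOp]
    · simp [expOp, sub_eq_add_neg, add_comm]
  have hB : ∀ s : ℝ, HasDerivAt (fun s : ℝ => c * (s ^ (k + 1) / (k + 1))) (c * s ^ k) s := by
    intro s
    have := ((hasDerivAt_pow (k + 1) s).div_const ((k : ℝ) + 1)).const_mul c
    convert! this using 1
    push_cast
    have : (k : ℝ) + 1 ≠ 0 := by positivity
    field_simp
  have := image_norm_le_of_norm_deriv_right_le_deriv_boundary (a := 0) (b := t)
    (fun s _ => (hd s).continuousAt.continuousWithinAt) (fun s _ => (hd s).hasDerivWithinAt)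
    (by simp [expOp_zero]) hB
    (fun s hs => (norm_apply_le_of_norm_le_one (hA _ (by linarith [hs.2])) _).trans
      (h s ⟨hs.1, hs.2.le⟩)) (Set.right_mem_Icc.2 ht)
  simpa [expOp_zero] using this

end Exponential

/-! ### Generators of contraction semigroups and a criterion for pregenerators. -/

section Generator

variable {X : Type*} [NormedAddCommGroup X] [NormedSpace ℂ X]

/-- The right derivative at `0` of the orbit of `x` is `y`. -/
def HasOrbitDeriv (T : C0Semigroup X) (x y : X) : Prop :=
  Tendsto (fun t : ℝ≥0 => ((t : ℂ)⁻¹) • (T.toFun t x - x)) (𝓝[>] 0) (𝓝 y)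

/-- With $q_t=t^{-1}(T_tx-x)$ one has $(1+ct)x=T_tx+t(cx-q_t)$. Since $\|T_tx\|\le\|x\|$, this gives
$c\|x\|\le\|cx-q_t\|$; let $t\to0$. -/
lemma HasOrbitDeriv.dissipative {T : C0Semigroup X} (hT : ∀ t, ‖T.toFun t‖ ≤ 1) {x y : X}
    (h : HasOrbitDeriv T x y) {c : ℝ} (hc : 0 < c) : c * ‖x‖ ≤ ‖(c : ℂ) • x - y‖ := by
  have h1 : Tendsto (fun t : ℝ≥0 => ‖(c : ℂ) • x - ((t : ℂ)⁻¹) • (T.toFun t x - x)‖) (𝓝[>] 0)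
      (𝓝 ‖(c : ℂ) • x - y‖) := (tendsto_const_nhds.sub h).norm
  refine ge_of_tendsto h1 (eventually_nhdsWithin_of_forall fun t ht => ?_)
  have ht0 : (0 : ℝ) < t := ht
  have htc : (t : ℂ) ≠ 0 := by exact_mod_cast ht0.ne'
  have h2 : ‖T.toFun t x‖ ≤ ‖x‖ := by simpa using (T.toFun t).le_of_opNorm_le (hT t) x
  have h3 : ((1 + c * t : ℝ) : ℂ) • x
      = T.toFun t x + (t : ℂ) • ((c : ℂ) • x - ((t : ℂ)⁻¹) • (T.toFun t x - x)) := by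
    rw [smul_sub, smul_smul, smul_smul, mul_inv_cancel₀ htc, one_smul]
    push_cast
    rw [add_smul, one_smul, mul_comm (c : ℂ)]
    abel
  have h4 := congrArg norm h3
  rw [norm_smul, Complex.norm_real, Real.norm_of_nonneg (by positivity)] at h4
  have h5 := norm_add_le (T.toFun t x)
    ((t : ℂ) • ((c : ℂ) • x - ((t : ℂ)⁻¹) • (T.toFun t x - x)))
  rw [← h4, norm_smul] at h5
  have h6 : ‖(t : ℂ)‖ = t := by simp
  rw [h6] at h5
  have h7 : (t : ℝ) * (c * ‖x‖) ≤ t * ‖(c : ℂ) • x - ((t : ℂ)⁻¹) • (T.toFun t x - x)‖ := by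
    linarith
  exact le_of_mul_le_mul_left h7 ht0

lemma norm_orbit_sub_le {T : C0Semigroup X} (hT : ∀ t, ‖T.toFun t‖ ≤ 1) (x : X) {s r : ℝ}
    (hs : 0 ≤ s) (hr : 0 ≤ r) :
    ‖T.toFun s.toNNReal x - T.toFun r.toNNReal x‖ ≤ ‖T.toFun (|s - r|).toNNReal x - x‖ := by
  have key : ∀ p q : ℝ, 0 ≤ p → p ≤ q →
      ‖T.toFun q.toNNReal x - T.toFun p.toNNReal x‖ ≤ ‖T.toFun (q - p).toNNReal x - x‖ := by
    intro p q hp hpq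
    have h1 : q.toNNReal = p.toNNReal + (q - p).toNNReal := by
      rw [← Real.toNNReal_add hp (by linarith)]; congr 1; ring
    rw [h1, T.map_add]
    change ‖T.toFun p.toNNReal (T.toFun (q - p).toNNReal x) - T.toFun p.toNNReal x‖ ≤ _
    rw [← map_sub]
    simpa using (T.toFun p.toNNReal).le_of_opNorm_le (hT _) (T.toFun (q - p).toNNReal x - x)
  rcases le_total r s with h | h
  · rw [abs_of_nonneg (by linarith)]; exact key r s hr h
  · rw [norm_sub_rev, abs_sub_comm, abs_of_nonneg (by linarith)]; exact key s r hs h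

lemma continuousOn_orbit {T : C0Semigroup X} (hT : ∀ t, ‖T.toFun t‖ ≤ 1) (x : X) :
    ContinuousOn (fun s : ℝ => T.toFun s.toNNReal x) (Set.Ici 0) := by
  intro r hr
  have h1 : Tendsto (fun s : ℝ => ‖T.toFun (|s - r|).toNNReal x - x‖) (𝓝 r) (𝓝 0) := by
    have h2 : Tendsto (fun s : ℝ => (|s - r|).toNNReal) (𝓝 r) (𝓝 0) := by
      have : Continuous fun s : ℝ => (|s - r|).toNNReal := by fun_prop
      simpa using this.tendsto r
    simpa using (((T.tendsto_zero x).comp h2).sub_const x).norm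
  exact tendsto_iff_norm_sub_tendsto_zero.2 (squeeze_zero' (Eventually.of_forall fun _ =>
    norm_nonneg _) (eventually_nhdsWithin_of_forall fun s hs => norm_orbit_sub_le hT x hs hr)
    (h1.mono_left nhdsWithin_le_nhds))

/-- For $z>s$ the increment is $T_s(T_{z-s}x-x)$, so the derivative at $0$ is transported by $T_s$.
A right derivative is all that the mean value inequality needs. -/
lemma HasOrbitDeriv.hasDerivWithinAt {T : C0Semigroup X} {x y : X} (h : HasOrbitDeriv T x y)
    {s : ℝ} (hs : 0 ≤ s) :
    HasDerivWithinAt (fun r : ℝ => T.toFun r.toNNReal x) (T.toFun s.toNNReal y) (Set.Ici s) s := by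
  rw [hasDerivWithinAt_iff_tendsto_slope, Set.Ici_sdiff_left]
  have h1 : Tendsto (fun z : ℝ => (z - s).toNNReal) (𝓝[>] s) (𝓝[>] 0) := by
    refine tendsto_nhdsWithin_iff.2 ⟨?_, ?_⟩
    · have : Continuous fun z : ℝ => (z - s).toNNReal := by fun_prop
      simpa using (this.tendsto s).mono_left nhdsWithin_le_nhds
    · refine eventually_nhdsWithin_of_forall fun z hz => ?_
      simpa using hz
  have h2 := ((T.toFun s.toNNReal).continuous.tendsto y).comp (h.comp h1)
  refine h2.congr' (eventually_nhdsWithin_of_forall fun z hz => ?_)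
  have hz' : s < z := hz
  have h3 : z.toNNReal = s.toNNReal + (z - s).toNNReal := by
    rw [← Real.toNNReal_add hs (by linarith)]; congr 1; ring
  simp only [Function.comp, slope_def_module]
  rw [h3, T.map_add, map_smul, map_sub, Real.coe_toNNReal _ (by linarith : 0 ≤ z - s),
    ← Complex.ofReal_inv, Complex.coe_smul]
  rfl

/-- A quantitative form of differentiability whose error depends on $y$ only; it therefore survives
limits of pairs $(x,y)$, which is how closedness of the generator is obtained. -/
lemma HasOrbitDeriv.norm_sub_le {T : C0Semigroup X} (hT : ∀ t, ‖T.toFun t‖ ≤ 1) {x y : X}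
    (h : HasOrbitDeriv T x y) {t : ℝ≥0} {η : ℝ} (hη : ∀ s ≤ t, ‖T.toFun s y - y‖ ≤ η) :
    ‖T.toFun t x - x - (t : ℂ) • y‖ ≤ η * t := by
  have h1 : ContinuousOn (fun s : ℝ => T.toFun s.toNNReal x - s • y) (Set.Icc 0 (t : ℝ)) :=
    ((continuousOn_orbit hT x).mono Set.Icc_subset_Ici_self).sub (by fun_prop)
  have h2 : ∀ s ∈ Set.Ico 0 (t : ℝ), HasDerivWithinAt (fun s : ℝ => T.toFun s.toNNReal x - s • y)
      (T.toFun s.toNNReal y - y) (Set.Ici s) s := by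
    intro s hs
    refine (h.hasDerivWithinAt hs.1).sub ?_
    simpa using ((hasDerivAt_id s).smul_const y).hasDerivWithinAt
  have h3 := norm_image_sub_le_of_norm_deriv_right_le_segment h1 h2 (C := η)
    (fun s hs => hη _ (Real.toNNReal_le_iff_le_coe.2 hs.2.le)) t (Set.right_mem_Icc.2 t.2)
  have h4 : T.toFun t x - x - (t : ℂ) • y = T.toFun (t : ℝ).toNNReal x - (t : ℝ) • y -
      (T.toFun (0 : ℝ).toNNReal x - (0 : ℝ) • y) := by
    rw [Real.toNNReal_coe, Real.toNNReal_zero, T.map_zero, Complex.coe_smul]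
    simp only [one_apply_eq_self, zero_smul, sub_zero]
    abel
  rw [h4]
  simpa using h3

/-- The generator of a contraction semigroup is closed. -/
lemma isClosed_hasOrbitDeriv {T : C0Semigroup X} (hT : ∀ t, ‖T.toFun t‖ ≤ 1) :
    IsClosed {p : X × X | HasOrbitDeriv T p.1 p.2} := by
  refine isClosed_of_closure_subset ?_
  rintro ⟨x, y⟩ hxy
  obtain ⟨p, hp, hlim⟩ := mem_closure_iff_seq_limit.1 hxy
  have hx : Tendsto (fun k => (p k).1) atTop (𝓝 x) := (continuous_fst.tendsto _).comp hlim
  have hy : Tendsto (fun k => (p k).2) atTop (𝓝 y) := (continuous_snd.tendsto _).comp hlim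
  change Tendsto _ _ _
  rw [Metric.tendsto_nhds]
  intro ε hε
  have h1 : ∀ᶠ t : ℝ≥0 in 𝓝 0, ‖T.toFun t y - y‖ < ε / 4 := by
    have : Tendsto (fun t => ‖T.toFun t y - y‖) (𝓝 0) (𝓝 0) := by
      simpa using ((T.tendsto_zero y).sub_const y).norm
    exact this.eventually (gt_mem_nhds (by positivity))
  obtain ⟨δ, hδ, hball⟩ := Metric.eventually_nhds_iff.1 h1
  have h2 : ∀ t : ℝ≥0, (t : ℝ) < δ →
      ‖T.toFun t x - x - (t : ℂ) • y‖ ≤ ε / 2 * t := by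
    intro t ht
    have h3 : Tendsto (fun k => ‖T.toFun t (p k).1 - (p k).1 - (t : ℂ) • (p k).2‖) atTop
        (𝓝 ‖T.toFun t x - x - (t : ℂ) • y‖) :=
      (((((T.toFun t).continuous.tendsto x).comp hx).sub hx).sub (hy.const_smul _)).norm
    have h4 : ∀ᶠ k in atTop, ‖(p k).2 - y‖ < ε / 8 := by
      have := (tendsto_iff_norm_sub_tendsto_zero.1 hy)
      exact this.eventually (gt_mem_nhds (by positivity))
    -- The budget for $\|T_sy_k-y_k\|$ is $\varepsilon/8+\varepsilon/4+\varepsilon/8=\varepsilon/2$.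
    refine le_of_tendsto h3 (h4.mono fun k hk => (hp k).norm_sub_le hT fun s hs => ?_)
    have h5 : ‖T.toFun s y - y‖ < ε / 4 := by
      refine hball ?_
      rw [NNReal.dist_eq]
      simp only [NNReal.coe_zero, sub_zero, NNReal.abs_eq]
      exact lt_of_le_of_lt (NNReal.coe_le_coe.2 hs) ht
    have h6 : ‖T.toFun s ((p k).2 - y)‖ ≤ ‖(p k).2 - y‖ := by
      simpa using (T.toFun s).le_of_opNorm_le (hT s) ((p k).2 - y)
    have h7 : T.toFun s (p k).2 - (p k).2
        = T.toFun s ((p k).2 - y) + (T.toFun s y - y) - ((p k).2 - y) := by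
      rw [map_sub]; abel
    rw [h7]
    have := norm_sub_le (T.toFun s ((p k).2 - y) + (T.toFun s y - y)) ((p k).2 - y)
    have := norm_add_le (T.toFun s ((p k).2 - y)) (T.toFun s y - y)
    linarith
  have h8 : ∀ᶠ t : ℝ≥0 in 𝓝[>] 0, (t : ℝ) < δ := by
    refine nhdsWithin_le_nhds ?_
    have : Tendsto (fun t : ℝ≥0 => (t : ℝ)) (𝓝 0) (𝓝 0) := by
      simpa using NNReal.continuous_coe.tendsto 0
    exact this.eventually (gt_mem_nhds hδ)
  filter_upwards [h8, self_mem_nhdsWithin] with t ht ht0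
  have ht0' : (0 : ℝ) < t := ht0
  have htc : (t : ℂ) ≠ 0 := by exact_mod_cast ht0'.ne'
  have h9 : ((t : ℂ)⁻¹) • (T.toFun t x - x) - y
      = ((t : ℂ)⁻¹) • (T.toFun t x - x - (t : ℂ) • y) := by
    rw [smul_sub _ _ ((t : ℂ) • y), smul_smul, inv_mul_cancel₀ htc, one_smul]
  rw [dist_eq_norm, h9, norm_smul, norm_inv]
  have h10 : ‖(t : ℂ)‖ = t := by simp
  rw [h10, inv_mul_lt_iff₀ ht0']
  nlinarith [h2 t ht]

lemma HasOrbitDeriv.sub {T : C0Semigroup X} {x y x' y' : X} (h : HasOrbitDeriv T x y)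
    (h' : HasOrbitDeriv T x' y') : HasOrbitDeriv T (x - x') (y - y') := by
  refine (Tendsto.sub h h').congr fun t => ?_
  rw [← smul_sub, map_sub]
  congr 1
  abel

/-- An operator contained in the generator `G` of a contraction semigroup, such that the range of
`c - L` is dense for some `c > 0`, is a pregenerator. -/
theorem isPregenerator_of_dense_range {T : C0Semigroup X} (hT : ∀ t, ‖T.toFun t‖ ≤ 1)
    {L : X →ₗ.[ℂ] X} (hL : ∀ x : L.domain, HasOrbitDeriv T x (L x)) {c : ℝ} (hc : 0 < c)
    (hrange : ∀ y : X, y ∈ closure (Set.range fun x : L.domain => (c : ℂ) • (x : X) - L x)) :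
    IsPregenerator T L := by
  have hgraph : ∀ p ∈ L.graph.topologicalClosure, HasOrbitDeriv T p.1 p.2 := by
    intro p hp
    refine closure_minimal ?_ (isClosed_hasOrbitDeriv hT) hp
    rintro ⟨x, y⟩ hq
    obtain ⟨z, h1, h2⟩ := (LinearPMap.mem_graph_iff L).1 hq
    have := hL z
    change HasOrbitDeriv T x y
    rwa [h1, h2] at this
  -- The closed graph lies in the graph of the generator, so it is single-valued: the orbit of $0$
  -- has derivative $0$.
  have hcl : L.IsClosable := by
    refine ⟨L.graph.topologicalClosure.toLinearPMap, ?_⟩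
    rw [Submodule.toLinearPMap_graph_eq]
    rintro ⟨x, y⟩ hp hx
    have h1 := hgraph _ hp
    simp only at hx
    subst hx
    refine tendsto_nhds_unique h1 ?_
    simp
  refine ⟨hcl, fun x y => ?_⟩
  rw [← hcl.graph_closure_eq_closure_graph]
  refine ⟨fun h => hgraph _ h, fun h => ?_⟩
  change HasOrbitDeriv T x y at h
  -- For $(x,y)$ in the generator, approximate $cx-y$ by $(c-L)z_k$. Dissipativity of the generator
  -- bounds $c\|z_k-x\|$ by the error, so $z_k\to x$ and then $Lz_k\to y$.
  obtain ⟨w, hw, hlim⟩ := mem_closure_iff_seq_limit.1 (hrange ((c : ℂ) • x - y))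
  choose z hz using hw
  have hx : Tendsto (fun k => ((z k : L.domain) : X)) atTop (𝓝 x) := by
    refine tendsto_iff_norm_sub_tendsto_zero.2 ?_
    have h1 : Tendsto (fun k => c⁻¹ * ‖w k - ((c : ℂ) • x - y)‖) atTop (𝓝 0) := by
      simpa using (tendsto_iff_norm_sub_tendsto_zero.1 hlim).const_mul c⁻¹
    refine squeeze_zero (fun _ => norm_nonneg _) (fun k => ?_) h1
    rw [le_inv_mul_iff₀ hc]
    have h2 := ((hL (z k)).sub h).dissipative hT hc
    refine h2.trans (le_of_eq ?_)
    rw [← hz k, smul_sub, sub_sub_sub_comm]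
  have hy : Tendsto (fun k => L (z k)) atTop (𝓝 y) := by
    have h1 : Tendsto (fun k => (c : ℂ) • ((z k : L.domain) : X) - w k) atTop
        (𝓝 ((c : ℂ) • x - ((c : ℂ) • x - y))) := (hx.const_smul _).sub hlim
    rw [sub_sub_cancel] at h1
    refine h1.congr fun k => ?_
    rw [← hz k, sub_sub_cancel]
  refine mem_closure_of_tendsto (hx.prodMk_nhds hy) (Eventually.of_forall fun k => ?_)
  exact L.mem_graph (z k)

end Generator

/-! ### Limits of bounded contraction semigroups under local approximation. -/

section Approximation

variable {X : Type*} [NormedAddCommGroup X] [NormedSpace ℂ X]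

/-- A point outside the closure of a subspace is separated from it by a functional that vanishes
on the subspace. -/
lemma exists_functional_of_notMem_closure (W : Submodule ℂ X) {y : X}
    (hy : y ∉ closure (W : Set X)) : ∃ f : X →L[ℂ] ℂ, (∀ w ∈ W, f w = 0) ∧ f y ≠ 0 := by
  have : IsClosed (W.topologicalClosure : Set X) := W.isClosed_topologicalClosure
  -- Hahn–Banach is applied in the quotient by the closed subspace, where the class of $y$ is
  -- nonzero.
  have h1 : (Submodule.Quotient.mk y : X ⧸ W.topologicalClosure) ≠ 0 := by
    rwa [Ne, Submodule.Quotient.mk_eq_zero]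
  obtain ⟨g, -, hg⟩ := exists_dual_vector ℂ _ (norm_ne_zero_iff.2 h1)
  refine ⟨g.comp W.topologicalClosure.mkQL, fun w hw => ?_, ?_⟩
  · have : (Submodule.Quotient.mk w : X ⧸ W.topologicalClosure) = 0 :=
      (Submodule.Quotient.mk_eq_zero _).2 (W.le_topologicalClosure hw)
    change g (Submodule.Quotient.mk w) = 0
    rw [this, map_zero]
  · change g (Submodule.Quotient.mk y) ≠ 0
    rw [hg]
    exact RCLike.ofReal_ne_zero.2 (norm_ne_zero_iff.2 h1)

/-- An increasing sequence of subspaces `V n` with dense union, and bounded operators `A n` that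
generate contraction semigroups, leave `V n` invariant, stabilise on `V n` after one step, and are
such that `A (n + 1)` differs from `A n` on `V n` by at most `M n`. -/
structure LocalApprox (X : Type*) [NormedAddCommGroup X] [NormedSpace ℂ X] where
  V : ℕ → Submodule ℂ X
  A : ℕ → X →L[ℂ] X
  M : ℝ
  mono : Monotone V
  dense : ∀ x, x ∈ closure (⋃ n, (V n : Set X))
  contraction : ∀ n t, 0 ≤ t → ‖expOp (A n) t‖ ≤ 1
  map_mem : ∀ n, ∀ a ∈ V n, A n a ∈ V n
  stable : ∀ n m, n < m → ∀ a ∈ V n, A m a = A (n + 1) a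
  M_nonneg : 0 ≤ M
  norm_sub_le : ∀ n, 1 ≤ n → ∀ a ∈ V n, ‖A (n + 1) a - A n a‖ ≤ M * n * ‖a‖

namespace LocalApprox

/-- The approximation given by the closures of the subspaces. -/
def closed (P : LocalApprox X) : LocalApprox X where
  V n := (P.V n).topologicalClosure
  A := P.A
  M := P.M
  mono _ _ h := Submodule.topologicalClosure_mono (P.mono h)
  dense x := closure_mono (Set.iUnion_mono fun n => (P.V n).le_topologicalClosure) (P.dense x)
  contraction := P.contraction
  map_mem n a ha := by
    have h : Set.MapsTo (P.A n) (P.V n) (P.V n) := P.map_mem n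
    exact h.closure (P.A n).continuous ha
  stable n m h a ha := by
    have : IsClosed {a | P.A m a = P.A (n + 1) a} :=
      isClosed_eq (P.A m).continuous (P.A (n + 1)).continuous
    exact closure_minimal (P.stable n m h) this ha
  M_nonneg := P.M_nonneg
  norm_sub_le n hn a ha := by
    have : IsClosed {a | ‖P.A (n + 1) a - P.A n a‖ ≤ P.M * n * ‖a‖} :=
      isClosed_le (by fun_prop) (by fun_prop)
    exact closure_minimal (P.norm_sub_le n hn) this ha

variable (P : LocalApprox X)

lemma norm_expOp_apply_le (n : ℕ) {t : ℝ} (ht : 0 ≤ t) (a : X) : ‖expOp (P.A n) t a‖ ≤ ‖a‖ :=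
  norm_apply_le_of_norm_le_one (P.contraction n t ht) a

/-- A time up to which the approximating evolutions converge directly. -/
def shortTime : ℝ := 1 / (2 * (P.M + 1))

lemma shortTime_pos : 0 < P.shortTime := by
  have := P.M_nonneg
  unfold shortTime
  positivity

lemma mul_shortTime_lt_one : P.M * P.shortTime < 1 := by
  have := P.M_nonneg
  unfold shortTime
  rw [mul_one_div, div_lt_one (by positivity)]
  linarith

lemma exists_mem_near (a : X) {ε : ℝ} (hε : 0 < ε) :
    ∃ n, 1 ≤ n ∧ ∃ b ∈ P.V n, ‖a - b‖ < ε := by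
  obtain ⟨b, hb, hab⟩ := Metric.mem_closure_iff.1 (P.dense a) ε hε
  obtain ⟨n, hn⟩ := Set.mem_iUnion.1 hb
  exact ⟨n + 1, by omega, b, P.mono (Nat.le_succ n) hn, by rwa [← dist_eq_norm]⟩

lemma tendsto_expOp_comp {s : ℝ} (hs : 0 ≤ s) {u : ℕ → X} {y z : X}
    (hu : Tendsto u atTop (𝓝 y)) (hz : Tendsto (fun m => expOp (P.A m) s y) atTop (𝓝 z)) :
    Tendsto (fun m => expOp (P.A m) s (u m)) atTop (𝓝 z) := by
  have h1 : Tendsto (fun m => expOp (P.A m) s (u m - y)) atTop (𝓝 0) := by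
    refine squeeze_zero_norm (fun m => P.norm_expOp_apply_le m hs _) ?_
    exact tendsto_iff_norm_sub_tendsto_zero.1 hu
  simpa using h1.add hz

variable [CompleteSpace X]

lemma expOp_mem (n : ℕ) (t : ℝ) {a : X} (ha : a ∈ P.closed.V n) :
    expOp (P.A n) t a ∈ P.closed.V n :=
  expOp_apply_mem (P.V n).isClosed_topologicalClosure (P.closed.map_mem n) t ha

/-- Duhamel integrates the residual bound in time. It is stated with the residual as a hypothesis
because the induction in `norm_residual_le` calls it at each step. -/
lemma norm_expOp_succ_sub_le_of_residual {n k : ℕ} (a : X)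
    (h : ∀ t : ℝ, 0 ≤ t → ‖P.A (n + k + 1) (expOp (P.A (n + k)) t a) -
      P.A (n + k) (expOp (P.A (n + k)) t a)‖ ≤
        (P.M * n * (n + k).choose k * P.M ^ k * ‖a‖) * t ^ k) {t : ℝ} (ht : 0 ≤ t) :
    ‖expOp (P.A (n + k + 1)) t a - expOp (P.A (n + k)) t a‖ ≤
      (n + k).choose (k + 1) * (P.M * t) ^ (k + 1) * ‖a‖ := by
  refine (norm_expOp_sub_expOp_le (P.contraction _) k ht fun s hs => h s hs.1).trans
    (le_of_eq ?_)
  -- The factor $1/(k+1)$ from integrating $t^k$ is absorbed by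
  -- $(k+1)\binom{n+k}{k+1}=n\binom{n+k}{k}$.
  have h1 : ((n + k).choose (k + 1) : ℝ) * (k + 1) = (n + k).choose k * n := by
    have := Nat.choose_succ_right_eq (n + k) k
    rw [Nat.add_sub_cancel] at this
    exact_mod_cast this
  have h2 : (k : ℝ) + 1 ≠ 0 := by positivity
  rw [mul_pow]
  field_simp
  linear_combination (-P.M ^ (k + 1) * ‖a‖ * t ^ (k + 1)) * h1

/-- The approximating evolutions of `a ∈ V n` leave the `V (n + k)` only slowly. -/
lemma norm_residual_le {n : ℕ} (hn : 1 ≤ n) {a : X} (ha : a ∈ P.V n) (k : ℕ) :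
    ∀ t : ℝ, 0 ≤ t → ‖P.A (n + k + 1) (expOp (P.A (n + k)) t a) -
      P.A (n + k) (expOp (P.A (n + k)) t a)‖ ≤
        (P.M * n * (n + k).choose k * P.M ^ k * ‖a‖) * t ^ k := by
  have ha' : ∀ m, n ≤ m → a ∈ P.closed.V m := fun m hm =>
    (P.V m).le_topologicalClosure (P.mono hm ha)
  induction k with
  | zero =>
    intro t ht
    have h1 := P.closed.norm_sub_le n hn _ (P.expOp_mem n t (ha' n le_rfl))
    have h2 := P.norm_expOp_apply_le n ht a
    have h3 : 0 ≤ P.M * n := mul_nonneg P.M_nonneg (Nat.cast_nonneg n)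
    simpa using! h1.trans (mul_le_mul_of_nonneg_left h2 h3)
  | succ k ih =>
    intro t ht
    have h0 := P.norm_expOp_succ_sub_le_of_residual a ih ht
    set m := n + k with hm
    have h1 : n + (k + 1) = m + 1 := by omega
    rw [h1]
    have hu : expOp (P.A m) t a ∈ P.closed.V m := P.expOp_mem m t (ha' m (by omega))
    have hv : expOp (P.A (m + 1)) t a ∈ P.closed.V (m + 1) :=
      P.expOp_mem (m + 1) t (ha' (m + 1) (by omega))
    -- $A_{m+2}-A_{m+1}$ kills $e^{tA_m}a$, which is still in the closure of $V_m$. Only the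
    -- difference of two consecutive evolutions is left, and Duhamel has already bounded it by one
    -- more power of $t$.
    have h2 : P.A (m + 1 + 1) (expOp (P.A m) t a) = P.A (m + 1) (expOp (P.A m) t a) :=
      P.closed.stable m (m + 1 + 1) (by omega) _ hu
    have h3 := P.closed.norm_sub_le (m + 1) (by omega) _
      (sub_mem hv (P.closed.mono (Nat.le_succ m) hu))
    have h4 : P.A (m + 1 + 1) (expOp (P.A (m + 1)) t a - expOp (P.A m) t a) -
        P.A (m + 1) (expOp (P.A (m + 1)) t a - expOp (P.A m) t a) =
        P.A (m + 1 + 1) (expOp (P.A (m + 1)) t a) - P.A (m + 1) (expOp (P.A (m + 1)) t a) := by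
      rw [map_sub, map_sub, h2, sub_sub_sub_cancel_right]
    have h3' : ‖P.A (m + 1 + 1) (expOp (P.A (m + 1)) t a) -
        P.A (m + 1) (expOp (P.A (m + 1)) t a)‖ ≤
        P.M * ((m + 1 : ℕ) : ℝ) * ‖expOp (P.A (m + 1)) t a - expOp (P.A m) t a‖ := h4 ▸ h3
    refine h3'.trans ?_
    have h5 : 0 ≤ P.M * ((m + 1 : ℕ) : ℝ) := mul_nonneg P.M_nonneg (Nat.cast_nonneg _)
    refine (mul_le_mul_of_nonneg_left h0 h5).trans (le_of_eq ?_)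
    -- The growth factor $m+1$ of the new step only advances the binomial coefficient, so no
    -- factorial builds up.
    have h6 : (m.choose (k + 1) : ℝ) * ((m + 1 : ℕ) : ℝ) = (m + 1).choose (k + 1) * n := by
      have := Nat.choose_mul_succ_eq m (k + 1)
      rw [show m + 1 - (k + 1) = n by omega] at this
      exact_mod_cast this
    rw [mul_pow]
    linear_combination (P.M ^ (k + 2) * t ^ (k + 1) * ‖a‖) * h6

lemma norm_expOp_succ_sub_le {n : ℕ} (hn : 1 ≤ n) {a : X} (ha : a ∈ P.V n) (k : ℕ) {t : ℝ}
    (ht : 0 ≤ t) : ‖expOp (P.A (n + k + 1)) t a - expOp (P.A (n + k)) t a‖ ≤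
      (n + k).choose (k + 1) * (P.M * t) ^ (k + 1) * ‖a‖ :=
  P.norm_expOp_succ_sub_le_of_residual a (P.norm_residual_le hn ha k) ht

/-- Since $\binom{n+k}{k+1}=\binom{n+k}{n-1}$ is polynomial in $k$ for fixed $n$, the increments are
summable against $(Mt)^{k+1}$ as soon as $Mt<1$. The admissible time does not depend on $n$. -/
lemma cauchySeq_expOp_of_mem {n : ℕ} (hn : 1 ≤ n) {a : X} (ha : a ∈ P.V n) {t : ℝ} (ht : 0 ≤ t)
    (ht' : t ≤ P.shortTime) : CauchySeq fun m => expOp (P.A m) t a := by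
  have hMt : 0 ≤ P.M * t := mul_nonneg P.M_nonneg ht
  have hr : ‖P.M * t‖ < 1 := by
    rw [Real.norm_of_nonneg hMt]
    exact (mul_le_mul_of_nonneg_left ht' P.M_nonneg).trans_lt P.mul_shortTime_lt_one
  have hs : Summable fun k : ℕ => ((n + k).choose (k + 1) : ℝ) * (P.M * t) ^ (k + 1) * ‖a‖ := by
    have h0 := summable_choose_mul_geometric_of_norm_lt_one (n - 1) hr
    have h1 : Summable fun k : ℕ =>
        (((k + 1 + (n - 1)).choose (n - 1) : ℕ) : ℝ) * (P.M * t) ^ (k + 1) :=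
      h0.comp_injective (add_left_injective 1)
    refine (h1.congr fun k => ?_).mul_right ‖a‖
    rw [show k + 1 + (n - 1) = n + k by omega,
      Nat.choose_symm_of_eq_add (show n + k = (k + 1) + (n - 1) by omega)]
  rw [← cauchySeq_shift n]
  refine cauchySeq_of_summable_dist (hs.of_nonneg_of_le (fun _ => dist_nonneg) fun k => ?_)
  rw [dist_comm, dist_eq_norm, add_comm k n, show k.succ + n = n + k + 1 by omega]
  exact P.norm_expOp_succ_sub_le hn ha k ht

lemma cauchySeq_expOp_of_le {t : ℝ} (ht : 0 ≤ t) (ht' : t ≤ P.shortTime) (a : X) :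
    CauchySeq fun m => expOp (P.A m) t a := by
  rw [Metric.cauchySeq_iff]
  intro ε hε
  obtain ⟨n, hn, b, hb, hab⟩ := P.exists_mem_near a (show 0 < ε / 3 by positivity)
  obtain ⟨N, hN⟩ := Metric.cauchySeq_iff.1 (P.cauchySeq_expOp_of_mem hn hb ht ht') (ε / 3)
    (by positivity)
  refine ⟨N, fun p hp q hq => ?_⟩
  have h1 : ∀ m, dist (expOp (P.A m) t a) (expOp (P.A m) t b) < ε / 3 := fun m => by
    rw [dist_eq_norm, ← map_sub]
    exact (P.norm_expOp_apply_le m ht _).trans_lt hab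
  have h2 := h1 p
  have h3 := h1 q
  rw [dist_comm] at h3
  have h4 := dist_triangle4 (expOp (P.A p) t a) (expOp (P.A p) t b) (expOp (P.A q) t b)
    (expOp (P.A q) t a)
  have := hN p hp q hq
  linarith

/-- Split $t$ into $N$ steps within the short time and compose the limits; contractivity uniform in
$m$ permits composition of strong limits. -/
lemma exists_tendsto_expOp {t : ℝ} (ht : 0 ≤ t) (a : X) :
    ∃ y, Tendsto (fun m => expOp (P.A m) t a) atTop (𝓝 y) := by
  have key : ∀ N : ℕ, ∀ s : ℝ, 0 ≤ s → s ≤ P.shortTime →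
      ∃ y, Tendsto (fun m => expOp (P.A m) (N * s) a) atTop (𝓝 y) := by
    intro N s hs hs'
    induction N with
    | zero => exact ⟨a, by simp [expOp_zero]⟩
    | succ N ih =>
      obtain ⟨y, hy⟩ := ih
      obtain ⟨z, hz⟩ := cauchySeq_tendsto_of_complete (P.cauchySeq_expOp_of_le hs hs' y)
      refine ⟨z, (P.tendsto_expOp_comp hs hy hz).congr fun m => ?_⟩
      rw [show ((N + 1 : ℕ) : ℝ) * s = s + N * s by push_cast; ring, expOp_add]
      rfl
  obtain ⟨N, hN⟩ := exists_nat_gt (t / P.shortTime)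
  have hN0 : (0 : ℝ) < N := (div_nonneg ht P.shortTime_pos.le).trans_lt hN
  have h1 : t / N ≤ P.shortTime := by
    rw [div_lt_iff₀ P.shortTime_pos] at hN
    rw [div_le_iff₀ hN0]
    linarith
  have h2 := key N (t / N) (by positivity) h1
  rwa [mul_div_cancel₀ _ hN0.ne'] at h2

/-- The limit of the approximating evolutions. -/
def limitFun (t : ℝ≥0) (a : X) : X := (P.exists_tendsto_expOp t.2 a).choose

lemma tendsto_limitFun (t : ℝ≥0) (a : X) :
    Tendsto (fun m => expOp (P.A m) t a) atTop (𝓝 (P.limitFun t a)) :=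
  (P.exists_tendsto_expOp t.2 a).choose_spec

lemma norm_limitFun_le (t : ℝ≥0) (a : X) : ‖P.limitFun t a‖ ≤ ‖a‖ :=
  le_of_tendsto (P.tendsto_limitFun t a).norm
    (Eventually.of_forall fun m => P.norm_expOp_apply_le m t.2 a)

/-- The limit of the approximating evolutions, as a bounded operator. -/
def limitOp (t : ℝ≥0) : X →L[ℂ] X :=
  LinearMap.mkContinuous
    { toFun := P.limitFun t
      map_add' := fun a b => tendsto_nhds_unique (P.tendsto_limitFun t (a + b)) <| by
        simpa using (P.tendsto_limitFun t a).add (P.tendsto_limitFun t b)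
      map_smul' := fun c a => tendsto_nhds_unique (P.tendsto_limitFun t (c • a)) <| by
        simpa using (P.tendsto_limitFun t a).const_smul c }
    1 (fun a => by simpa using P.norm_limitFun_le t a)

lemma tendsto_limitOp (t : ℝ≥0) (a : X) :
    Tendsto (fun m => expOp (P.A m) t a) atTop (𝓝 (P.limitOp t a)) :=
  P.tendsto_limitFun t a

lemma norm_limitOp_le (t : ℝ≥0) : ‖P.limitOp t‖ ≤ 1 :=
  LinearMap.mkContinuous_norm_le _ zero_le_one _

lemma expOp_hasDerivWithinAt (m : ℕ) (a : X) (s : ℝ) (S : Set ℝ) :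
    HasDerivWithinAt (fun s : ℝ => expOp (P.A m) s a) (expOp (P.A m) s (P.A m a)) S s :=
  (hasDerivAt_expOp_apply (P.A m) a s).hasDerivWithinAt

lemma norm_expOp_apply_sub_le (m : ℕ) {t : ℝ} (ht : 0 ≤ t) (a : X) :
    ‖expOp (P.A m) t a - a‖ ≤ ‖P.A m a‖ * t := by
  have := norm_image_sub_le_of_norm_deriv_right_le_segment (a := 0) (b := t) (C := ‖P.A m a‖)
    (fun s _ => (P.expOp_hasDerivWithinAt m a s _).continuousWithinAt)
    (fun s _ => P.expOp_hasDerivWithinAt m a s _)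
    (fun s hs => P.norm_expOp_apply_le m hs.1 _) t (Set.right_mem_Icc.2 ht)
  simpa [expOp_zero] using this

lemma norm_expOp_apply_sub_sub_le (m : ℕ) {t : ℝ} (ht : 0 ≤ t) (a : X) :
    ‖expOp (P.A m) t a - a - (t : ℂ) • P.A m a‖ ≤ ‖P.A m (P.A m a)‖ * t * t := by
  have hd : ∀ s : ℝ, HasDerivAt (fun s : ℝ => expOp (P.A m) s a - s • P.A m a)
      (expOp (P.A m) s (P.A m a) - P.A m a) s := fun s => by
    refine (hasDerivAt_expOp_apply (P.A m) a s).sub ?_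
    simpa using (hasDerivAt_id s).smul_const (P.A m a)
  have := norm_image_sub_le_of_norm_deriv_right_le_segment (a := 0) (b := t)
    (C := ‖P.A m (P.A m a)‖ * t) (fun s _ => (hd s).continuousAt.continuousWithinAt)
    (fun s _ => (hd s).hasDerivWithinAt)
    (fun s hs => (P.norm_expOp_apply_sub_le m hs.1 _).trans
      (mul_le_mul_of_nonneg_left hs.2.le (norm_nonneg _))) t (Set.right_mem_Icc.2 ht)
  simp only [expOp_zero, one_apply_eq_self, zero_smul, sub_zero] at this
  rwa [Complex.coe_smul, sub_right_comm]

/-- The second-order Taylor remainder is uniform in $m$: for $m\ge n+2$ both $A_ma$ and $A_m^2a$ no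
longer depend on $m$. -/
lemma norm_limitOp_apply_sub_sub_le {n : ℕ} {a : X} (ha : a ∈ P.V n) (t : ℝ≥0) :
    ‖P.limitOp t a - a - (t : ℂ) • P.A (n + 1) a‖ ≤
      ‖P.A (n + 2) (P.A (n + 1) a)‖ * t * t := by
  have h1 : Tendsto (fun m => ‖expOp (P.A m) t a - a - (t : ℂ) • P.A (n + 1) a‖) atTop
      (𝓝 ‖P.limitOp t a - a - (t : ℂ) • P.A (n + 1) a‖) :=
    (((P.tendsto_limitOp t a).sub_const a).sub_const _).norm
  refine le_of_tendsto h1 ((eventually_ge_atTop (n + 2)).mono fun m hm => ?_)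
  have h2 : P.A m a = P.A (n + 1) a := P.stable n m (by omega) a ha
  have h3 : P.A m (P.A (n + 1) a) = P.A (n + 2) (P.A (n + 1) a) :=
    P.stable (n + 1) m (by omega) _ (P.map_mem _ _ (P.mono (Nat.le_succ n) ha))
  have h4 := P.norm_expOp_apply_sub_sub_le m t.2 a
  rw [h2, h3] at h4
  exact h4

lemma norm_limitOp_apply_sub_le {n : ℕ} {a : X} (ha : a ∈ P.V n) (t : ℝ≥0) :
    ‖P.limitOp t a - a‖ ≤ ‖P.A (n + 1) a‖ * t := by
  have h1 : Tendsto (fun m => ‖expOp (P.A m) t a - a‖) atTop (𝓝 ‖P.limitOp t a - a‖) :=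
    ((P.tendsto_limitOp t a).sub_const a).norm
  refine le_of_tendsto h1 ((eventually_ge_atTop (n + 1)).mono fun m hm => ?_)
  have h4 := P.norm_expOp_apply_sub_le m t.2 a
  rwa [P.stable n m (by omega) a ha] at h4

lemma tendsto_coe_nnreal_zero : Tendsto (fun t : ℝ≥0 => (t : ℝ)) (𝓝 0) (𝓝 0) := by
  simpa using NNReal.continuous_coe.tendsto 0

/-- The contraction semigroup of a local approximation. -/
def semigroup : C0Semigroup X where
  toFun := P.limitOp
  map_zero := by
    ext a
    refine tendsto_nhds_unique (P.tendsto_limitOp 0 a) ?_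
    simp [expOp_zero]
  map_add s t := by
    ext a
    refine tendsto_nhds_unique (P.tendsto_limitOp (s + t) a) ?_
    refine (P.tendsto_expOp_comp s.2 (P.tendsto_limitOp t a)
      (P.tendsto_limitOp s (P.limitOp t a))).congr fun m => ?_
    rw [NNReal.coe_add, expOp_add]
    rfl
  tendsto_zero a := by
    rw [Metric.tendsto_nhds]
    intro ε hε
    obtain ⟨n, -, b, hb, hab⟩ := P.exists_mem_near a (show 0 < ε / 3 by positivity)
    have h1 : ∀ᶠ t : ℝ≥0 in 𝓝 0, ‖P.A (n + 1) b‖ * t < ε / 3 := by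
      have : Tendsto (fun t : ℝ≥0 => ‖P.A (n + 1) b‖ * t) (𝓝 0) (𝓝 0) := by
        simpa using tendsto_coe_nnreal_zero.const_mul ‖P.A (n + 1) b‖
      exact this.eventually (gt_mem_nhds (by positivity))
    filter_upwards [h1] with t ht
    have h2 := P.norm_limitOp_apply_sub_le hb t
    have h3 : ‖P.limitOp t (a - b)‖ ≤ ‖a - b‖ :=
      norm_apply_le_of_norm_le_one (P.norm_limitOp_le t) _
    have h4 : P.limitOp t a - a = P.limitOp t (a - b) + (P.limitOp t b - b) - (a - b) := by
      rw [map_sub]; abel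
    rw [dist_eq_norm, h4]
    have h5 := _root_.norm_sub_le (P.limitOp t (a - b) + (P.limitOp t b - b)) (a - b)
    have h6 := norm_add_le (P.limitOp t (a - b)) (P.limitOp t b - b)
    linarith

lemma hasOrbitDeriv {n : ℕ} {a : X} (ha : a ∈ P.V n) :
    HasOrbitDeriv P.semigroup a (P.A (n + 1) a) := by
  have h1 : Tendsto (fun t : ℝ≥0 => ‖P.A (n + 2) (P.A (n + 1) a)‖ * (t : ℝ)) (𝓝[>] 0) (𝓝 0) := by
    simpa using (tendsto_coe_nnreal_zero.const_mul _).mono_left nhdsWithin_le_nhds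
  refine tendsto_iff_norm_sub_tendsto_zero.2 (squeeze_zero' (Eventually.of_forall fun _ =>
    norm_nonneg _) (eventually_nhdsWithin_of_forall fun t ht => ?_) h1)
  have ht0 : (0 : ℝ) < t := ht
  have htc : (t : ℂ) ≠ 0 := by exact_mod_cast ht0.ne'
  have h2 := P.norm_limitOp_apply_sub_sub_le ha t
  have h3 : ((t : ℂ)⁻¹) • (P.limitOp t a - a) - P.A (n + 1) a
      = ((t : ℂ)⁻¹) • (P.limitOp t a - a - (t : ℂ) • P.A (n + 1) a) := by
    rw [smul_sub _ _ ((t : ℂ) • _), smul_smul, inv_mul_cancel₀ htc, one_smul]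
  change ‖((t : ℂ)⁻¹) • (P.limitOp t a - a) - P.A (n + 1) a‖ ≤ _
  have h4 : ‖(t : ℂ)‖ = t := by simp
  rw [h3, norm_smul, norm_inv, h4, inv_mul_le_iff₀ ht0]
  linarith

/-- A functional that annihilates the range of `1 - A (n + 1)` on every `V n` satisfies
`|f a| ≤ e^{-s} ‖f‖ ‖a‖`, where `s` is the short time. -/
lemma norm_functional_le (f : X →L[ℂ] ℂ) (hf : ∀ n, ∀ a ∈ P.V n, f (a - P.A (n + 1) a) = 0)
    (a : X) : ‖f a‖ ≤ Real.exp (-P.shortTime) * ‖f‖ * ‖a‖ := by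
  have hf' : ∀ n, ∀ a ∈ P.closed.V n, f (P.A (n + 1) a) = f a := by
    intro n a ha
    have hc : IsClosed {a | f (P.A (n + 1) a) = f a} := isClosed_eq (by fun_prop) (by fun_prop)
    refine closure_minimal (fun b hb => ?_) hc ha
    have := hf n b hb
    rw [map_sub, sub_eq_zero] at this
    exact this.symm
  set τ := P.shortTime with hτ
  have hτ0 : 0 ≤ τ := P.shortTime_pos.le
  have key : ∀ n, 1 ≤ n → ∀ b ∈ P.V n, ‖f b‖ ≤ Real.exp (-τ) * ‖f‖ * ‖b‖ := by
    intro n hn b hb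
    have hd : ∀ m s, HasDerivAt (fun s : ℝ => Real.exp (-s) • f (expOp (P.A m) s b))
        (Real.exp (-s) • (f (P.A m (expOp (P.A m) s b)) - f (expOp (P.A m) s b))) s := by
      intro m s
      have h1 : HasDerivAt (fun s : ℝ => f (expOp (P.A m) s b))
          (f (P.A m (expOp (P.A m) s b))) s := by
        rw [expOp_apply_comm]
        exact ((f.restrictScalars ℝ).hasFDerivAt.comp_hasDerivAt s
          (hasDerivAt_expOp_apply (P.A m) b s))
      have h2 : HasDerivAt (fun s : ℝ => Real.exp (-s)) (-Real.exp (-s)) s := by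
        simpa using (hasDerivAt_neg s).exp
      convert! h2.smul h1 using 1
      rw [smul_sub, neg_smul]
      abel
    -- The derivative of $e^{-s}f(e^{sA_m}b)$ is $e^{-s}f((A_m-1)u)$ with $u=e^{sA_m}b$. As
    -- $f(u)=f(A_{m+1}u)$, it is $f$ of a residual up to sign, which tends to $0$ as $k\to\infty$
    -- for $s\le\tau$.
    have hbound : ∀ k : ℕ, ‖f b‖ ≤ Real.exp (-τ) * ‖f‖ * ‖b‖ +
        ‖f‖ * (P.M * n * (n + k).choose k * P.M ^ k * ‖b‖ * τ ^ k) * τ := by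
      intro k
      set m := n + k with hm
      have hu : ∀ s, expOp (P.A m) s b ∈ P.closed.V m := fun s =>
        P.expOp_mem m s ((P.V m).le_topologicalClosure (P.mono (by omega) hb))
      have h1 : ∀ s ∈ Set.Ico (0 : ℝ) τ,
          ‖Real.exp (-s) • (f (P.A m (expOp (P.A m) s b)) - f (expOp (P.A m) s b))‖ ≤
          ‖f‖ * (P.M * n * (n + k).choose k * P.M ^ k * ‖b‖ * τ ^ k) := by
        intro s hs
        rw [← hf' m _ (hu s), ← map_sub, norm_smul, Real.norm_of_nonneg (Real.exp_pos _).le]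
        have h2 : Real.exp (-s) ≤ 1 := Real.exp_le_one_iff.2 (by linarith [hs.1])
        have h3 := P.norm_residual_le hn hb k s hs.1
        rw [norm_sub_rev] at h3
        have h4 : s ^ k ≤ τ ^ k := pow_le_pow_left₀ hs.1 hs.2.le k
        have hM := P.M_nonneg
        have h5 : 0 ≤ P.M * n * (n + k).choose k * P.M ^ k * ‖b‖ := by positivity
        have h6 := (f.le_opNorm (P.A m (expOp (P.A m) s b) -
          P.A (m + 1) (expOp (P.A m) s b))).trans (mul_le_mul_of_nonneg_left
            (h3.trans (mul_le_mul_of_nonneg_left h4 h5)) (norm_nonneg f))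
        exact (mul_le_of_le_one_left (norm_nonneg _) h2).trans h6
      have h7 := norm_image_sub_le_of_norm_deriv_right_le_segment (a := 0) (b := τ)
        (fun s _ => (hd m s).continuousAt.continuousWithinAt)
        (fun s _ => (hd m s).hasDerivWithinAt) h1 τ (Set.right_mem_Icc.2 hτ0)
      simp only [neg_zero, Real.exp_zero, expOp_zero, one_apply_eq_self, one_smul, sub_zero] at h7
      have h8 : ‖Real.exp (-τ) • f (expOp (P.A m) τ b)‖ ≤ Real.exp (-τ) * ‖f‖ * ‖b‖ := by
        rw [norm_smul, Real.norm_of_nonneg (Real.exp_pos _).le, mul_assoc]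
        refine mul_le_mul_of_nonneg_left ?_ (Real.exp_pos _).le
        exact (f.le_opNorm _).trans
          (mul_le_mul_of_nonneg_left (P.norm_expOp_apply_le m hτ0 b) (norm_nonneg f))
      have h9 := norm_sub_norm_le (f b) (Real.exp (-τ) • f (expOp (P.A m) τ b))
      rw [norm_sub_rev] at h9
      linarith
    have hr : ‖P.M * τ‖ < 1 := by
      rw [Real.norm_of_nonneg (mul_nonneg P.M_nonneg hτ0)]
      exact P.mul_shortTime_lt_one
    have hlim := (summable_choose_mul_geometric_of_norm_lt_one n hr).tendsto_atTop_zero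
    have hlim2 : Tendsto (fun k : ℕ => Real.exp (-τ) * ‖f‖ * ‖b‖ +
        (‖f‖ * P.M * n * ‖b‖ * τ) * (((k + n).choose n : ℝ) * (P.M * τ) ^ k)) atTop
        (𝓝 (Real.exp (-τ) * ‖f‖ * ‖b‖)) := by
      simpa using (hlim.const_mul (‖f‖ * P.M * n * ‖b‖ * τ)).const_add
        (Real.exp (-τ) * ‖f‖ * ‖b‖)
    refine ge_of_tendsto hlim2 (Eventually.of_forall fun k => (hbound k).trans (le_of_eq ?_))
    rw [add_comm k n, Nat.choose_symm_add, mul_pow]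
    ring
  have hc : IsClosed {a | ‖f a‖ ≤ Real.exp (-τ) * ‖f‖ * ‖a‖} :=
    isClosed_le (by fun_prop) (by fun_prop)
  refine closure_minimal ?_ hc (P.dense a)
  intro b hb
  obtain ⟨n, hn⟩ := Set.mem_iUnion.1 hb
  -- The index is raised by one because the residual bound needs $n\ge1$.
  exact key (n + 1) (by omega) b (P.mono (Nat.le_succ n) hn)

/-- The previous bound yields $\|f\|\le e^{-\tau}\|f\|$ with $\tau>0$; control on a short time
interval is therefore enough. -/
lemma functional_eq_zero (f : X →L[ℂ] ℂ) (hf : ∀ n, ∀ a ∈ P.V n, f (a - P.A (n + 1) a) = 0) :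
    f = 0 := by
  have h1 : ‖f‖ ≤ Real.exp (-P.shortTime) * ‖f‖ :=
    f.opNorm_le_bound (by positivity) (P.norm_functional_le f hf)
  have h2 : Real.exp (-P.shortTime) < 1 := by
    rw [Real.exp_lt_one_iff]
    linarith [P.shortTime_pos]
  have h3 := norm_nonneg f
  rw [← norm_eq_zero]
  nlinarith

lemma mem_closure_range {L : X →ₗ.[ℂ] X} (hdom : ∀ n, P.V n ≤ L.domain)
    (hL : ∀ n, ∀ x : L.domain, (x : X) ∈ P.V n → L x = P.A (n + 1) x) (y : X) :
    y ∈ closure (Set.range fun x : L.domain => ((1 : ℝ) : ℂ) • (x : X) - L x) := by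
  have hW : (Set.range fun x : L.domain => ((1 : ℝ) : ℂ) • (x : X) - L x) =
      (LinearMap.range (L.domain.subtype - L.toFun) : Set X) := by
    ext z
    simp [LinearPMap.toFun_eq_coe]
  rw [hW]
  by_contra hy
  obtain ⟨f, hfW, hfy⟩ := exists_functional_of_notMem_closure _ hy
  refine hfy ?_
  rw [P.functional_eq_zero f fun n a ha => ?_]
  · simp
  · rw [← hL n ⟨a, hdom n ha⟩ ha]
    exact hfW _ ⟨⟨a, hdom n ha⟩, rfl⟩

/-- The operator on `⋃ n, V n` given by a local approximation is a dissipative pregenerator of a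
contraction semigroup. -/
theorem exists_isPregenerator {L : X →ₗ.[ℂ] X} (hdom : ∀ x ∈ L.domain, ∃ n, x ∈ P.V n)
    (hdom' : ∀ n, P.V n ≤ L.domain)
    (hL : ∀ n, ∀ x : L.domain, (x : X) ∈ P.V n → L x = P.A (n + 1) x) :
    (∃ T : C0Semigroup X, (∀ t, ‖T.toFun t‖ ≤ 1) ∧ IsPregenerator T L) ∧ IsDissipative L := by
  have hder : ∀ x : L.domain, HasOrbitDeriv P.semigroup x (L x) := by
    intro x
    obtain ⟨n, hn⟩ := hdom x x.2
    rw [hL n x hn]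
    exact P.hasOrbitDeriv hn
  have hT : ∀ t, ‖P.semigroup.toFun t‖ ≤ 1 := P.norm_limitOp_le
  have hpre : IsPregenerator P.semigroup L :=
    isPregenerator_of_dense_range hT hder one_pos (P.mem_closure_range hdom' hL)
  exact ⟨⟨P.semigroup, hT, hpre⟩, fun x c hc => (hder x).dissipative hT hc⟩

end LocalApprox
end Approximation

/-! ### Contractivity to first order of Lindblad generators on a Hilbert space. -/

section Hilbert

variable {H : Type*} [NormedAddCommGroup H] [InnerProductSpace ℂ H] [CompleteSpace H]

/-- A completely positive map `a ↦ ∑ Vᵢ^* a Vᵢ` with `∑ Vᵢ^* Vᵢ ≤ c` has norm at most `c`. -/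
lemma norm_sum_star_mul_mul_le {ι : Type*} (s : Finset ι) (V : ι → H →L[ℂ] H) {c : ℝ} (hc : 0 ≤ c)
    (hV : ∀ x, ∑ i ∈ s, ‖V i x‖ ^ 2 ≤ c * ‖x‖ ^ 2) (a : H →L[ℂ] H) :
    ‖∑ i ∈ s, star (V i) * a * V i‖ ≤ c * ‖a‖ := by
  set B := ∑ i ∈ s, star (V i) * a * V i with hB
  refine B.opNorm_le_bound (by positivity) fun y => ?_
  have h1 : ∀ x, ‖inner ℂ x (B y)‖ ≤ ‖a‖ * (c * (‖x‖ * ‖y‖)) := by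
    intro x
    have h2 : inner ℂ x (B y) = ∑ i ∈ s, inner ℂ (V i x) (a (V i y)) := by
      rw [hB, sum_apply, inner_sum]
      refine Finset.sum_congr rfl fun i _ => ?_
      rw [mul_assoc]
      change inner ℂ x ((ContinuousLinearMap.adjoint (V i)) (a (V i y))) = _
      rw [ContinuousLinearMap.adjoint_inner_right]
    have h3 : ∑ i ∈ s, ‖V i x‖ * ‖V i y‖ ≤ c * (‖x‖ * ‖y‖) := by
      refine (Real.sum_mul_le_sqrt_mul_sqrt s _ _).trans ?_
      refine (mul_le_mul (Real.sqrt_le_sqrt (hV x)) (Real.sqrt_le_sqrt (hV y))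
        (Real.sqrt_nonneg _) (Real.sqrt_nonneg _)).trans (le_of_eq ?_)
      rw [Real.sqrt_mul hc, Real.sqrt_mul hc, Real.sqrt_sq (norm_nonneg _),
        Real.sqrt_sq (norm_nonneg _)]
      linear_combination (‖x‖ * ‖y‖) * Real.mul_self_sqrt hc
    rw [h2]
    calc ‖∑ i ∈ s, inner ℂ (V i x) (a (V i y))‖
        ≤ ∑ i ∈ s, ‖a‖ * (‖V i x‖ * ‖V i y‖) := by
          refine norm_sum_le_of_le s fun i _ => ?_
          refine (norm_inner_le_norm _ _).trans ?_
          nlinarith [a.le_opNorm (V i y), norm_nonneg (V i x)]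
      _ ≤ ‖a‖ * (c * (‖x‖ * ‖y‖)) := by
          rw [← Finset.mul_sum]
          exact mul_le_mul_of_nonneg_left h3 (norm_nonneg a)
  -- Testing the sesquilinear bound at $x=By$ makes the left side $\|By\|^2$; one factor is then
  -- cancelled.
  have h4 := h1 (B y)
  rw [inner_self_eq_norm_sq_to_K] at h4
  have h5 : ‖B y‖ ^ 2 ≤ ‖a‖ * (c * (‖B y‖ * ‖y‖)) := by simpa using h4
  by_cases h6 : ‖B y‖ = 0
  · rw [h6]; positivity
  · have h7 : 0 < ‖B y‖ := lt_of_le_of_ne (norm_nonneg _) (Ne.symm h6)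
    refine le_of_mul_le_mul_left ?_ h7
    linarith

/-- First order contractivity of a Lindblad generator. -/
lemma norm_add_lindblad_le {ι : Type*} (s : Finset ι) (t : ι → H →L[ℂ] H) (K : H →L[ℂ] H)
    (hK : star K = K) : ∃ C : ℝ, ∀ (ε : ℝ) (a : H →L[ℂ] H), 0 ≤ ε →
      ‖a + (ε : ℂ) • (Complex.I • (K * a - a * K) + ∑ i ∈ s, -((1 / 2 : ℂ) •
        (star (t i) * (t i * a - a * t i) + (a * star (t i) - star (t i) * a) * t i)))‖ ≤
      (1 + C * ε ^ 2) * ‖a‖ := by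
  set p : H →L[ℂ] H := ∑ i ∈ s, star (t i) * t i with hp
  have hps : star p = p := by simp [hp, star_sum]
  set G : H →L[ℂ] H := -((1 / 2 : ℂ) • p) - Complex.I • K with hG
  have hGs : star G = -((1 / 2 : ℂ) • p) + Complex.I • K := by
    rw [hG, star_sub, star_neg, star_smul, star_smul, hps, hK]
    simp
  refine ⟨‖G‖ ^ 2 + ‖G‖ ^ 2, fun ε a hε => ?_⟩
  -- Kraus operators of one Euler step: `none` carries the drift $1+\varepsilon G$, and the factor
  -- $\sqrt\varepsilon$ makes each jump contribute $\varepsilon\,t_i^*at_i$.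
  set V : Option ι → H →L[ℂ] H := fun o => o.elim (1 + (ε : ℂ) • G)
    fun i => ((Real.sqrt ε : ℝ) : ℂ) • t i with hV
  have hsq : ((Real.sqrt ε : ℝ) : ℂ) * ((Real.sqrt ε : ℝ) : ℂ) = (ε : ℂ) := by
    rw [← Complex.ofReal_mul, Real.mul_self_sqrt hε]
  have hre : ∀ x, (inner ℂ x (G x)).re = -(1 / 2) * ∑ i ∈ s, ‖t i x‖ ^ 2 := by
    intro x
    have h1 : inner ℂ x (p x) = ((∑ i ∈ s, ‖t i x‖ ^ 2 : ℝ) : ℂ) := by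
      rw [hp, sum_apply, inner_sum, Complex.ofReal_sum]
      refine Finset.sum_congr rfl fun i _ => ?_
      change inner ℂ x ((ContinuousLinearMap.adjoint (t i)) (t i x)) = _
      rw [ContinuousLinearMap.adjoint_inner_right, inner_self_eq_norm_sq_to_K]
      simp
    have h2 : (inner ℂ x (K x)).im = 0 := by
      have h3 : inner ℂ (K x) x = inner ℂ x (K x) := by
        conv_lhs => rw [← hK]
        exact ContinuousLinearMap.adjoint_inner_left K x x
      have h4 := inner_conj_symm (𝕜 := ℂ) x (K x)
      rw [h3] at h4
      exact Complex.conj_eq_iff_im.1 h4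
    have h5 : inner ℂ x (G x) = -((1 / 2 : ℂ) * inner ℂ x (p x)) -
        Complex.I * inner ℂ x (K x) := by
      rw [hG]
      simp [inner_neg_right, inner_smul_right]
    rw [h5, h1]
    simp only [Complex.sub_re, Complex.neg_re, Complex.mul_re, Complex.I_re, Complex.I_im, h2,
      Complex.ofReal_re, Complex.ofReal_im]
    norm_num
  -- The terms linear in $\varepsilon$ cancel, since $2\,\mathrm{Re}\langle
  -- x,Gx\rangle=-\sum_i\|t_ix\|^2$; what remains is $\varepsilon^2\|Gx\|^2$.
  have hsum : ∀ x, ∑ o ∈ s.insertNone, ‖V o x‖ ^ 2 ≤ (1 + ε ^ 2 * ‖G‖ ^ 2) * ‖x‖ ^ 2 := by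
    intro x
    rw [Finset.sum_insertNone]
    have h1 : ‖V none x‖ ^ 2 = ‖x‖ ^ 2 + 2 * ε * (inner ℂ x (G x)).re + ε ^ 2 * ‖G x‖ ^ 2 := by
      change ‖x + (ε : ℂ) • G x‖ ^ 2 = _
      rw [@norm_add_sq ℂ, inner_smul_right, norm_smul, mul_pow, Complex.norm_real, Real.norm_eq_abs,
        sq_abs]
      simp
      ring
    have h2 : ∀ i, ‖V (some i) x‖ ^ 2 = ε * ‖t i x‖ ^ 2 := by
      intro i
      change ‖((Real.sqrt ε : ℝ) : ℂ) • t i x‖ ^ 2 = _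
      rw [norm_smul, mul_pow, Complex.norm_real, Real.norm_eq_abs, sq_abs, Real.sq_sqrt hε]
    simp only [h1, h2, hre]
    rw [← Finset.mul_sum]
    have h3 : ‖G x‖ ^ 2 ≤ ‖G‖ ^ 2 * ‖x‖ ^ 2 := by
      rw [← mul_pow]
      exact pow_le_pow_left₀ (norm_nonneg _) (G.le_opNorm x) 2
    nlinarith [mul_le_mul_of_nonneg_left h3 (sq_nonneg ε)]
  have hcp := norm_sum_star_mul_mul_le s.insertNone V (by positivity) hsum a
  have hterm : ∑ i ∈ s, -((1 / 2 : ℂ) •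
      (star (t i) * (t i * a - a * t i) + (a * star (t i) - star (t i) * a) * t i)) =
      ∑ i ∈ s, star (t i) * a * t i - (1 / 2 : ℂ) • (p * a) - (1 / 2 : ℂ) • (a * p) := by
    rw [hp, Finset.sum_mul, Finset.mul_sum, Finset.smul_sum, Finset.smul_sum,
      ← Finset.sum_sub_distrib, ← Finset.sum_sub_distrib]
    refine Finset.sum_congr rfl fun i _ => ?_
    have : star (t i) * (t i * a - a * t i) + (a * star (t i) - star (t i) * a) * t i =
        star (t i) * t i * a + a * (star (t i) * t i) - (2 : ℂ) • (star (t i) * a * t i) := by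
      rw [two_smul]
      noncomm_ring
    rw [this]
    module
  -- The Euler step is the completely positive map minus the quadratic term $\varepsilon^2G^*aG$
  -- produced by the drift.
  have hid : a + (ε : ℂ) • (Complex.I • (K * a - a * K) + ∑ i ∈ s, -((1 / 2 : ℂ) •
        (star (t i) * (t i * a - a * t i) + (a * star (t i) - star (t i) * a) * t i))) =
      ∑ o ∈ s.insertNone, star (V o) * a * V o - ((ε : ℂ) ^ 2) • (star G * a * G) := by
    rw [hterm, Finset.sum_insertNone]
    have h1 : ∀ i, star (V (some i)) * a * V (some i) = (ε : ℂ) • (star (t i) * a * t i) := by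
      intro i
      change star (((Real.sqrt ε : ℝ) : ℂ) • t i) * a * (((Real.sqrt ε : ℝ) : ℂ) • t i) = _
      rw [star_smul, smul_mul_assoc, smul_mul_assoc, mul_smul_comm, smul_smul]
      congr 1
      rw [← hsq]
      simp
    have h2 : star (V none) * a * V none =
        a + (ε : ℂ) • (star G * a + a * G) + ((ε : ℂ) ^ 2) • (star G * a * G) := by
      change star (1 + (ε : ℂ) • G) * a * (1 + (ε : ℂ) • G) = _
      have h3 : star ((ε : ℂ) • G) = (ε : ℂ) • star G := by
        rw [star_smul]; simp
      rw [star_add, star_one, h3, add_mul, one_mul, mul_add, mul_one, add_mul, smul_mul_assoc,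
        mul_smul_comm, smul_mul_assoc, mul_smul_comm, smul_smul]
      module
    have h4 : star G * a + a * G =
        Complex.I • (K * a - a * K) - (1 / 2 : ℂ) • (p * a) - (1 / 2 : ℂ) • (a * p) := by
      rw [hGs, hG, add_mul, mul_sub, neg_mul, mul_neg, smul_mul_assoc, smul_mul_assoc,
        mul_smul_comm, mul_smul_comm]
      module
    simp only [h1, h2, h4]
    rw [← Finset.smul_sum]
    module
  rw [hid]
  have hlast : ‖((ε : ℂ) ^ 2) • (star G * a * G)‖ ≤ ε ^ 2 * (‖G‖ ^ 2 * ‖a‖) := by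
    rw [norm_smul, norm_pow, Complex.norm_real, Real.norm_eq_abs, sq_abs]
    refine mul_le_mul_of_nonneg_left ?_ (sq_nonneg ε)
    refine (norm_mul₃_le (a := star G) (b := a) (c := G)).trans (le_of_eq ?_)
    rw [norm_star]
    ring
  refine (norm_sub_le _ _).trans ((add_le_add hcp hlast).trans (le_of_eq ?_))
  ring

end Hilbert

/-! ### Finite Lindbladians on the CAR algebra. -/

section Fock

variable {R : Type*} (lt : R → R → Prop)

lemma norm_ann_le (r : R) : ‖ann lt r‖ ≤ 1 := by
  change ‖annOp lt r‖ ≤ 1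
  refine ContinuousLinearMap.opNorm_le_bound _ zero_le_one fun F => ?_
  rw [one_mul]
  exact norm_le_of_perm F _ (toggle r) (norm_annFun_le lt r F)

lemma norm_transport_le (α : R → R → ℂ) (r s : R) : ‖transport lt α r s‖ ≤ ‖α r s‖ := by
  unfold transport
  rw [norm_smul]
  refine mul_le_of_le_one_right (norm_nonneg _) ?_
  refine (norm_mul_le _ _).trans (mul_le_one₀ ?_ (norm_nonneg _) (norm_ann_le lt r))
  exact (norm_star (ann lt s)).le.trans (norm_ann_le lt s)

lemma tauTerm_apply (α : R → R → ℂ) (r s : R) (a : CAR lt) :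
    tauTerm lt α r s a = -((1 / 2 : ℂ) •
    (star (transport lt α r s) * (transport lt α r s * a - a * transport lt α r s) +
      (a * star (transport lt α r s) - star (transport lt α r s) * a) * transport lt α r s)) := rfl

lemma deltaTerm_apply (h : R → ℝ) (r : R) (a : CAR lt) :
    deltaTerm lt h r a = (Complex.I * (h r : ℂ)) •
    (star (ann lt r) * ann lt r * a - a * (star (ann lt r) * ann lt r)) := rfl

/-- Four products, each at most $\|t\|^2\|a\|$, times the prefactor $\frac12$. -/
lemma norm_tauTerm_le (α : R → R → ℂ) (r s : R) (a : CAR lt) :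
    ‖tauTerm lt α r s a‖ ≤ 2 * ‖α r s‖ ^ 2 * ‖a‖ := by
  rw [tauTerm_apply, norm_neg, norm_smul]
  set t := transport lt α r s
  have ht : ‖t‖ ≤ ‖α r s‖ := norm_transport_le lt α r s
  have hst : ‖star t‖ = ‖t‖ := norm_star t
  have h1 : ‖t * a - a * t‖ ≤ 2 * ‖t‖ * ‖a‖ := by
    refine (norm_sub_le _ _).trans ((add_le_add (norm_mul_le _ _) (norm_mul_le _ _)).trans
      (le_of_eq ?_))
    ring
  have h2 : ‖a * star t - star t * a‖ ≤ 2 * ‖t‖ * ‖a‖ := by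
    refine (norm_sub_le _ _).trans ((add_le_add (norm_mul_le _ _) (norm_mul_le _ _)).trans
      (le_of_eq ?_))
    rw [hst]
    ring
  have h3 : ‖star t * (t * a - a * t) + (a * star t - star t * a) * t‖ ≤
      4 * (‖t‖ ^ 2 * ‖a‖) := by
    refine (norm_add_le _ _).trans ((add_le_add (norm_mul_le _ _) (norm_mul_le _ _)).trans ?_)
    rw [hst]
    nlinarith [norm_nonneg t]
  have h4 : ‖(1 / 2 : ℂ)‖ = 1 / 2 := by norm_num
  have h5 : ‖t‖ ^ 2 * ‖a‖ ≤ ‖α r s‖ ^ 2 * ‖a‖ :=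
    mul_le_mul_of_nonneg_right (pow_le_pow_left₀ (norm_nonneg _) ht 2) (norm_nonneg a)
  rw [h4]
  linarith

/-- `τ_{r,s}` as a bounded operator. -/
def tauCLM (α : R → R → ℂ) (r s : R) : CAR lt →L[ℂ] CAR lt :=
  ⟨tauTerm lt α r s, by
    change Continuous fun a : CAR lt => tauTerm lt α r s a
    simp only [tauTerm_apply]
    fun_prop⟩

/-- `δ_r` as a bounded operator. -/
def deltaCLM (h : R → ℝ) (r : R) : CAR lt →L[ℂ] CAR lt :=
  ⟨deltaTerm lt h r, by
    change Continuous fun a : CAR lt => deltaTerm lt h r a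
    simp only [deltaTerm_apply]
    fun_prop⟩

/-- The Lindbladian of the finite set of sites `S`, a bounded operator. -/
def finiteLindbladian (α : R → R → ℂ) (h : R → ℝ) (S : Finset R) : CAR lt →L[ℂ] CAR lt :=
  ∑ r ∈ S, deltaCLM lt h r + ∑ q ∈ S ×ˢ S, tauCLM lt α q.1 q.2

lemma finiteLindbladian_apply (α : R → R → ℂ) (h : R → ℝ) (S : Finset R) (a : CAR lt) :
    finiteLindbladian lt α h S a =
      ∑ r ∈ S, deltaTerm lt h r a + ∑ q ∈ S ×ˢ S, tauTerm lt α q.1 q.2 a := by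
  simp [finiteLindbladian, tauCLM, deltaCLM]

/-- The inclusion of the CAR algebra into the operators on Fock space. -/
def carIncl : CAR lt →⋆ₐ[ℂ] (Fock R →L[ℂ] Fock R) :=
  StarSubalgebra.subtype _

/-- The Hamiltonian `∑ h_r b_r^* b_r` of a finite set of sites. -/
def hamiltonian (h : R → ℝ) (S : Finset R) : CAR lt :=
  ∑ r ∈ S, (h r : ℂ) • (star (ann lt r) * ann lt r)

lemma star_hamiltonian (h : R → ℝ) (S : Finset R) :
    star (hamiltonian lt h S) = hamiltonian lt h S := by
  unfold hamiltonian
  rw [star_sum]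
  refine Finset.sum_congr rfl fun r _ => ?_
  rw [star_smul, star_mul, star_star]
  simp

lemma sum_deltaTerm (h : R → ℝ) (S : Finset R) (a : CAR lt) :
    ∑ r ∈ S, deltaTerm lt h r a =
      Complex.I • (hamiltonian lt h S * a - a * hamiltonian lt h S) := by
  unfold hamiltonian
  rw [Finset.sum_mul, Finset.mul_sum, ← Finset.sum_sub_distrib, Finset.smul_sum]
  refine Finset.sum_congr rfl fun r _ => ?_
  rw [deltaTerm_apply, smul_mul_assoc, mul_smul_comm, ← smul_sub, smul_smul]

lemma norm_carIncl (a : CAR lt) : ‖carIncl lt a‖ = ‖a‖ := rfl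

/-- The inclusion into operators on Fock space is isometric, so the Hilbert space estimate applies
there, with the transport operators as jumps and $\sum_r h_rb_r^*b_r$ as Hamiltonian. -/
lemma norm_one_add_finiteLindbladian_le (α : R → R → ℂ) (h : R → ℝ) (S : Finset R) :
    ∃ C : ℝ, ∀ ε : ℝ, 0 ≤ ε → ‖1 + (ε : ℂ) • finiteLindbladian lt α h S‖ ≤ 1 + C * ε ^ 2 := by
  obtain ⟨C, hC⟩ := norm_add_lindblad_le (S ×ˢ S)
    (fun q : R × R => carIncl lt (transport lt α q.1 q.2)) (carIncl lt (hamiltonian lt h S))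
    (by rw [← map_star, star_hamiltonian])
  refine ⟨|C|, fun ε hε => ContinuousLinearMap.opNorm_le_bound _ (by positivity) fun a => ?_⟩
  have h2 := hC ε (carIncl lt a) hε
  simp only [← map_star, ← map_mul, ← map_sub, ← map_add, ← map_smul, ← map_neg, ← map_sum] at h2
  rw [norm_carIncl, norm_carIncl] at h2
  have h3 : (1 + (ε : ℂ) • finiteLindbladian lt α h S) a =
      a + (ε : ℂ) • finiteLindbladian lt α h S a := rfl
  rw [h3, finiteLindbladian_apply, sum_deltaTerm]
  simp only [tauTerm_apply]
  refine h2.trans (mul_le_mul_of_nonneg_right ?_ (norm_nonneg a))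
  nlinarith [le_abs_self C, sq_nonneg ε]

lemma ann_mem_localAlg {S : Set R} {r : R} (hr : r ∈ S) : ann lt r ∈ localAlg lt S :=
  StarAlgebra.subset_adjoin ℂ _ (Set.mem_image_of_mem _ hr)

lemma deltaTerm_mem (h : R → ℝ) {S : Set R} {r : R} (hr : r ∈ S) {a : CAR lt}
    (ha : a ∈ localAlg lt S) : deltaTerm lt h r a ∈ localAlg lt S := by
  have h1 := ann_mem_localAlg lt hr
  have h2 := mul_mem (star_mem h1) h1
  exact SMulMemClass.smul_mem _ (sub_mem (mul_mem h2 ha) (mul_mem ha h2))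

lemma tauTerm_mem (α : R → R → ℂ) {S : Set R} {r s : R} (hr : r ∈ S) (hs : s ∈ S) {a : CAR lt}
    (ha : a ∈ localAlg lt S) : tauTerm lt α r s a ∈ localAlg lt S := by
  have h1 : transport lt α r s ∈ localAlg lt S :=
    SMulMemClass.smul_mem _ (mul_mem (star_mem (ann_mem_localAlg lt hs)) (ann_mem_localAlg lt hr))
  have h2 := star_mem h1
  exact neg_mem (SMulMemClass.smul_mem _ (add_mem
    (mul_mem h2 (sub_mem (mul_mem h1 ha) (mul_mem ha h1)))
    (mul_mem (sub_mem (mul_mem ha h2) (mul_mem h2 ha)) h1)))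

lemma finiteLindbladian_mem (α : R → R → ℂ) (h : R → ℝ) (S : Finset R) {a : CAR lt}
    (ha : a ∈ localAlg lt (S : Set R)) :
    finiteLindbladian lt α h S a ∈ localAlg lt (S : Set R) := by
  rw [finiteLindbladian_apply]
  refine add_mem (sum_mem fun r hr => deltaTerm_mem lt h hr ha) (sum_mem fun q hq => ?_)
  exact tauTerm_mem lt α (Finset.mem_product.1 hq).1 (Finset.mem_product.1 hq).2 ha

/-- `𝒜₀` is dense in the CAR algebra. -/
lemma mem_closure_A₀ (a : CAR lt) : a ∈ closure (A₀ lt : Set (CAR lt)) := by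
  have hle : StarAlgebra.adjoin ℂ (Set.range (annOp lt)) ≤ (A₀ lt).map (carIncl lt) := by
    refine StarAlgebra.adjoin_le ?_
    rintro _ ⟨r, rfl⟩
    exact ⟨ann lt r, ann_mem_localAlg lt (Set.mem_univ r), rfl⟩
  rw [Topology.IsInducing.subtypeVal.closure_eq_preimage_closure_image]
  exact closure_mono hle a.2

variable [IsStrictTotalOrder R lt]

lemma delta_eq_sum (h : R → ℝ) (S : Finset R) (a : (A₀ lt).toSubalgebra.toSubmodule)
    (ha : (a : CAR lt) ∈ localAlg lt (S : Set R)) :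
    delta lt h a = ∑ r ∈ S, deltaTerm lt h r a := by
  refine finsum_eq_sum_of_support_subset _ fun r hr => ?_
  by_contra hrS
  exact hr (deltaTerm_eq_zero lt h hrS ha)

lemma truncLindbladian_eq (α : R → R → ℂ) (h : R → ℝ) (S : Finset R)
    (a : (A₀ lt).toSubalgebra.toSubmodule) (ha : (a : CAR lt) ∈ localAlg lt (S : Set R)) :
    truncLindbladian lt α h S a = finiteLindbladian lt α h S a := by
  unfold truncLindbladian
  rw [finiteLindbladian_apply, delta_eq_sum lt h S a ha, ← Finset.coe_product,
    finsum_mem_coe_finset]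

/-- A nonzero $\tau_{r,s}(a)$ needs a nonzero amplitude and a site in $S$; both sites then lie in
$T$. -/
lemma lindbladian_eq {α : R → R → ℂ} (hα : FiniteValency α) (h : R → ℝ) {S T : Finset R}
    (hST : S ⊆ T) (hT : ∀ r ∈ S, interacting α r ⊆ T) (a : (lindbladian lt hα h).domain)
    (ha : (a : CAR lt) ∈ localAlg lt (S : Set R)) :
    lindbladian lt hα h a = finiteLindbladian lt α h T a := by
  rw [finiteLindbladian_apply, ← delta_eq_sum lt h T a (localAlg_mono lt (by simpa using hST) ha)]
  change delta lt h a + ∑ᶠ q : R × R, tauTerm lt α q.1 q.2 (a : CAR lt) = _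
  congr 1
  refine finsum_eq_sum_of_support_subset _ ?_
  rintro ⟨r, s⟩ hq
  have h0 : α r s ≠ 0 := fun h => hq (tauTerm_eq_zero lt α (Or.inl h) ha)
  have h1 : r ∈ S ∨ s ∈ S := by
    by_contra hc
    exact hq (tauTerm_eq_zero lt α (Or.inr (not_or.1 hc)) ha)
  rw [Finset.coe_product]
  rcases h1 with h1 | h1
  · exact ⟨hST h1, hT r h1 (Or.inl h0)⟩
  · exact ⟨hT s h1 (Or.inr h0), hST h1⟩

/-- The difference between two finite Lindbladians on `𝒜_S` is a sum over the pairs of interacting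
sites that cross the boundary of `S`. -/
lemma norm_finiteLindbladian_sub_le (α : R → R → ℂ) (h : R → ℝ) {S T : Finset R} (hST : S ⊆ T)
    {a : CAR lt} (ha : a ∈ localAlg lt (S : Set R)) (E : Finset (R × R))
    (hE : ∀ r ∈ S, ∀ s ∉ S, (α r s ≠ 0 ∨ α s r ≠ 0) → (r, s) ∈ E) {c : ℝ}
    (hc : ∀ r ∈ S, ∀ s ∉ S, ‖α r s‖ ^ 2 ≤ c ∧ ‖α s r‖ ^ 2 ≤ c) (hc0 : 0 ≤ c) :
    ‖finiteLindbladian lt α h T a - finiteLindbladian lt α h S a‖ ≤ 4 * c * E.card * ‖a‖ := by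
  classical
  have h1 : ∑ r ∈ T, deltaTerm lt h r a = ∑ r ∈ S, deltaTerm lt h r a :=
    (Finset.sum_subset hST fun r _ hr => deltaTerm_eq_zero lt h hr ha).symm
  have h2 := Finset.sum_sdiff (f := fun q : R × R => tauTerm lt α q.1 q.2 a)
    (Finset.product_subset_product hST hST)
  rw [finiteLindbladian_apply, finiteLindbladian_apply, h1, ← h2, add_sub_add_left_eq_sub,
    add_sub_cancel_right]
  -- `E` lists pairs with the inner site first. The swapped copy covers the opposite hops, doubling
  -- the count, and the filter keeps only genuine crossings, to which `hc` applies.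
  set F : Finset (R × R) := (E ∪ E.image Prod.swap).filter
    fun q => (q.1 ∈ S ∧ q.2 ∉ S) ∨ (q.2 ∈ S ∧ q.1 ∉ S) with hF
  have hFE : (F.card : ℝ) ≤ 2 * E.card := by
    have := (Finset.card_filter_le (E ∪ E.image Prod.swap)
      fun q => (q.1 ∈ S ∧ q.2 ∉ S) ∨ (q.2 ∈ S ∧ q.1 ∉ S)).trans
      ((Finset.card_union_le E (E.image Prod.swap)).trans
        (Nat.add_le_add_left Finset.card_image_le _))
    rw [← hF, ← two_mul] at this
    exact_mod_cast this
  have h3 : ∀ q ∈ T ×ˢ T \ S ×ˢ S, tauTerm lt α q.1 q.2 a ≠ 0 → q ∈ F := by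
    rintro ⟨r, s⟩ hq hne
    have h0 : α r s ≠ 0 := fun h => hne (tauTerm_eq_zero lt α (Or.inl h) ha)
    have h4 : r ∈ S ∨ s ∈ S := by
      by_contra hc
      exact hne (tauTerm_eq_zero lt α (Or.inr (not_or.1 hc)) ha)
    have h5 : ¬ (r ∈ S ∧ s ∈ S) := by simpa using (Finset.mem_sdiff.1 hq).2
    rw [hF, Finset.mem_filter, Finset.mem_union, Finset.mem_image]
    by_cases hr : r ∈ S
    · have hs : s ∉ S := fun hs => h5 ⟨hr, hs⟩
      exact ⟨Or.inl (hE r hr s hs (Or.inl h0)), Or.inl ⟨hr, hs⟩⟩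
    · have hs : s ∈ S := h4.resolve_left hr
      exact ⟨Or.inr ⟨(s, r), hE s hs r hr (Or.inr h0), rfl⟩, Or.inr ⟨hs, hr⟩⟩
  have h6 : ∑ q ∈ T ×ˢ T \ S ×ˢ S, tauTerm lt α q.1 q.2 a =
      ∑ q ∈ (T ×ˢ T \ S ×ˢ S).filter (· ∈ F), tauTerm lt α q.1 q.2 a :=
    (Finset.sum_filter_of_ne h3).symm
  rw [h6]
  calc ‖∑ q ∈ (T ×ˢ T \ S ×ˢ S).filter (· ∈ F), tauTerm lt α q.1 q.2 a‖
      ≤ ∑ _q ∈ (T ×ˢ T \ S ×ˢ S).filter (· ∈ F), 2 * c * ‖a‖ := by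
        refine norm_sum_le_of_le _ fun q hq => (norm_tauTerm_le lt α q.1 q.2 a).trans ?_
        have h7 : ‖α q.1 q.2‖ ^ 2 ≤ c := by
          rcases (Finset.mem_filter.1 (Finset.mem_filter.1 hq).2).2 with h8 | h8
          · exact (hc _ h8.1 _ h8.2).1
          · exact (hc _ h8.1 _ h8.2).2
        exact mul_le_mul_of_nonneg_right (by linarith) (norm_nonneg a)
    _ ≤ F.card * (2 * c * ‖a‖) := by
        rw [Finset.sum_const, nsmul_eq_mul]
        refine mul_le_mul_of_nonneg_right ?_ (by positivity)
        exact_mod_cast Finset.card_le_card fun q hq => (Finset.mem_filter.1 hq).2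
    _ ≤ 2 * E.card * (2 * c * ‖a‖) := mul_le_mul_of_nonneg_right hFE (by positivity)
    _ = 4 * c * E.card * ‖a‖ := by ring

end Fock

/-! ### Counting and amplitude bounds on cubes in $\mathbb Z^d$. -/

section Lattice

/-- The sites `r` with `‖r‖_∞ ≤ m`, as a finite set. -/
def box (d m : ℕ) : Finset (Fin d → ℤ) := Fintype.piFinset fun _ => Finset.Icc (-(m : ℤ)) m

lemma mem_box {d m : ℕ} {r : Fin d → ℤ} : r ∈ box d m ↔ ‖r‖ ≤ m := by
  rw [box, Fintype.mem_piFinset, pi_norm_le_iff_of_nonneg (Nat.cast_nonneg m)]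
  refine forall_congr' fun i => ?_
  rw [Finset.mem_Icc, ← abs_le, Int.norm_eq_abs]
  exact_mod_cast Iff.rfl

lemma card_box (d m : ℕ) : (box d m).card = (2 * m + 1) ^ d := by
  rw [box, Fintype.card_piFinset]
  simp only [Int.card_Icc, Finset.prod_const, Finset.card_univ, Fintype.card_fin]
  congr 1
  omega

lemma coe_box (d D n : ℕ) : (box d (n * D) : Set (Fin d → ℤ)) = cube d D n := by
  ext r
  rw [Finset.mem_coe, mem_box, cube, Set.mem_ofPred_eq]
  push_cast
  rfl

lemma box_subset_box {d m m' : ℕ} (h : m ≤ m') : box d m ⊆ box d m' := fun r hr =>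
  mem_box.2 ((mem_box.1 hr).trans (by exact_mod_cast h))

lemma exists_subset_box {d : ℕ} {S : Set (Fin d → ℤ)} (hS : S.Finite) :
    ∃ m, S ⊆ box d m := by
  obtain ⟨C, hC⟩ := hS.isBounded.exists_norm_le
  obtain ⟨m, hm⟩ := exists_nat_ge C
  exact ⟨m, fun r hr => mem_box.2 ((hC r hr).trans hm)⟩

lemma HasRange.norm_sub_le {d D : ℕ} {α : (Fin d → ℤ) → (Fin d → ℤ) → ℂ} (h : HasRange α D)
    {r s : Fin d → ℤ} (hrs : α r s ≠ 0 ∨ α s r ≠ 0) : ‖r - s‖ ≤ D := by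
  by_contra! hc
  rcases hrs with h1 | h1
  · exact h1 (h r s hc)
  · exact h1 (h s r (by rwa [norm_sub_rev]))

lemma HasRange.finiteValency {d D : ℕ} {α : (Fin d → ℤ) → (Fin d → ℤ) → ℂ} (h : HasRange α D) :
    FiniteValency α := by
  intro r
  obtain ⟨m, hm⟩ := exists_nat_ge ‖r‖
  refine (box d (m + D)).finite_toSet.subset fun s hs => mem_box.2 ?_
  have h1 := h.norm_sub_le hs
  have h2 := norm_sub_norm_le s r
  rw [norm_sub_rev] at h2
  push_cast
  linarith

lemma HasRange.interacting_subset {d D : ℕ} {α : (Fin d → ℤ) → (Fin d → ℤ) → ℂ}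
    (h : HasRange α D) (n : ℕ) {r : Fin d → ℤ} (hr : r ∈ box d (n * D)) :
    interacting α r ⊆ box d ((n + 1) * D) := by
  intro s hs
  have h1 := h.norm_sub_le hs
  have h2 := norm_sub_norm_le s r
  have h3 := mem_box.1 hr
  rw [norm_sub_rev] at h2
  refine mem_box.2 ?_
  push_cast at h3 ⊢
  linarith

open Classical in
/-- A set that contains the pairs of sites at distance at most `D` that leave the cube `R_n`. -/
def boundaryPairs (d D n : ℕ) : Finset ((Fin d → ℤ) × (Fin d → ℤ)) :=
  ((box d (n * D) \ box d ((n - 1) * D)) ×ˢ box d D).image fun q => (q.1, q.1 + q.2)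

lemma mem_boundaryPairs {d D n : ℕ} (hn : 1 ≤ n) {r s : Fin d → ℤ} (hr : r ∈ box d (n * D))
    (hs : s ∉ box d (n * D)) (hrs : ‖r - s‖ ≤ D) : (r, s) ∈ boundaryPairs d D n := by
  refine Finset.mem_image.2 ⟨(r, s - r), Finset.mem_product.2 ⟨Finset.mem_sdiff.2 ⟨hr, ?_⟩, ?_⟩, ?_⟩
  · intro h1
    refine hs (mem_box.2 ?_)
    have h2 := norm_sub_norm_le s r
    have h3 := mem_box.1 h1
    rw [norm_sub_rev] at h2
    obtain ⟨k, rfl⟩ : ∃ k, n = k + 1 := ⟨n - 1, by omega⟩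
    rw [Nat.add_sub_cancel] at h3
    push_cast at h3 ⊢
    linarith
  · exact mem_box.2 (by rwa [norm_sub_rev])
  · simp

lemma pow_succ_sub_pow_succ_le {x y : ℝ} (hy : 0 ≤ y) (hyx : y ≤ x) (e : ℕ) :
    x ^ (e + 1) - y ^ (e + 1) ≤ (e + 1) * (x - y) * x ^ e := by
  induction e with
  | zero => simp
  | succ e ih =>
    have h1 : y ^ (e + 1) ≤ x ^ (e + 1) := pow_le_pow_left₀ hy hyx _
    have h2 := mul_le_mul_of_nonneg_left ih (hy.trans hyx)
    have h3 := mul_le_mul_of_nonneg_right h1 (sub_nonneg.2 hyx)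
    calc x ^ (e + 1 + 1) - y ^ (e + 1 + 1)
        = x * (x ^ (e + 1) - y ^ (e + 1)) + y ^ (e + 1) * (x - y) := by ring
      _ ≤ x * ((e + 1) * (x - y) * x ^ e) + x ^ (e + 1) * (x - y) := add_le_add h2 h3
      _ = (((e + 1 : ℕ) : ℝ) + 1) * (x - y) * x ^ (e + 1) := by push_cast; ring

/-- With $d=e+1$, the shell has $(2nD+1)^d-(2(n-1)D+1)^d\le 2Dd\,n^{d-1}(1+2D)^{d-1}$ sites, and
each has $(1+2D)^d$ candidate partners; this is the source of the exponent $2d-1$. -/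
lemma card_boundaryPairs_le (e D n : ℕ) (hn : 1 ≤ n) :
    ((boundaryPairs (e + 1) D n).card : ℝ) ≤
      2 * D * (e + 1) * n ^ e * (1 + 2 * D : ℝ) ^ (2 * (e + 1) - 1) := by
  classical
  obtain ⟨k, rfl⟩ : ∃ k, n = k + 1 := ⟨n - 1, by omega⟩
  have hsub : box (e + 1) (k * D) ⊆ box (e + 1) ((k + 1) * D) :=
    box_subset_box (Nat.mul_le_mul_right D (Nat.le_succ k))
  have h1 : (boundaryPairs (e + 1) D (k + 1)).card ≤
      (box (e + 1) ((k + 1) * D) \ box (e + 1) (k * D)).card * (box (e + 1) D).card := by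
    refine Finset.card_image_le.trans (le_of_eq ?_)
    rw [Finset.card_product, Nat.add_sub_cancel]
  have h2 : ((box (e + 1) ((k + 1) * D) \ box (e + 1) (k * D)).card : ℝ) =
      (2 * ((k + 1) * D) + 1) ^ (e + 1) - (2 * (k * D) + 1) ^ (e + 1) := by
    rw [Finset.cast_card_sdiff hsub, card_box, card_box]
    push_cast
    rfl
  have h3 : ((box (e + 1) D).card : ℝ) = (2 * D + 1) ^ (e + 1) := by
    rw [card_box]; push_cast; rfl
  have h4 : (2 * ((k + 1) * D) + 1 : ℝ) ^ (e + 1) - (2 * (k * D) + 1) ^ (e + 1) ≤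
      (e + 1) * (2 * D) * (2 * ((k + 1) * D) + 1) ^ e := by
    have hD : (0 : ℝ) ≤ D := Nat.cast_nonneg D
    refine (pow_succ_sub_pow_succ_le (by positivity) (by linarith) e).trans (le_of_eq ?_)
    ring
  have h5 : (2 * ((k + 1) * D) + 1 : ℝ) ^ e ≤ (k + 1) ^ e * (2 * D + 1) ^ e := by
    rw [← mul_pow]
    refine pow_le_pow_left₀ (by positivity) ?_ e
    have : (0 : ℝ) ≤ k := Nat.cast_nonneg k
    linarith
  have h6 : ((boundaryPairs (e + 1) D (k + 1)).card : ℝ) ≤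
      ((2 * ((k + 1) * D) + 1) ^ (e + 1) - (2 * (k * D) + 1) ^ (e + 1)) *
        (2 * D + 1) ^ (e + 1) := by
    rw [← h2, ← h3]
    exact_mod_cast h1
  refine h6.trans ?_
  calc ((2 * ((k + 1) * D) + 1 : ℝ) ^ (e + 1) - (2 * (k * D) + 1) ^ (e + 1)) *
        (2 * D + 1) ^ (e + 1)
      ≤ ((e + 1) * (2 * D) * ((k + 1) ^ e * (2 * D + 1) ^ e)) * (2 * D + 1) ^ (e + 1) := by
        refine mul_le_mul_of_nonneg_right (h4.trans ?_) (by positivity)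
        exact mul_le_mul_of_nonneg_left h5 (by positivity)
    _ = 2 * D * (e + 1) * ((k + 1 : ℕ) : ℝ) ^ e * (1 + 2 * D : ℝ) ^ (2 * (e + 1) - 1) := by
        rw [show 2 * (e + 1) - 1 = e + (e + 1) by omega, pow_add, add_comm (1 : ℝ)]
        push_cast
        ring

/-- The amplitudes across the boundary of the cube `R_n`. -/
lemma GrowthBound.sq_norm_le {e D n : ℕ} {K : ℝ} {α : (Fin (e + 1) → ℤ) → (Fin (e + 1) → ℤ) → ℂ}
    (hα : GrowthBound α K) (hK : 0 ≤ K) (hrange : HasRange α D) (hn : 1 ≤ n) (hD : 1 ≤ D)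
    {r s : Fin (e + 1) → ℤ} (h : (r ∈ box (e + 1) (n * D) ∧ s ∉ box (e + 1) (n * D)) ∨
      (s ∈ box (e + 1) (n * D) ∧ r ∉ box (e + 1) (n * D))) :
    ‖α r s‖ ^ 2 ≤ K * ((1 + if e + 1 = 1 then 1 else 0) * ((n : ℝ) * D) ^ (1 - (e : ℤ))) := by
  have hn' : (1 : ℝ) ≤ n := by exact_mod_cast hn
  have hD' : (1 : ℝ) ≤ D := by exact_mod_cast hD
  have hnD : (0 : ℝ) < n * D := by positivity
  by_cases h0 : α r s = 0
  · rw [h0]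
    simp only [norm_zero, ne_eq, OfNat.ofNat_ne_zero, not_false_eq_true, zero_pow]
    split_ifs <;> positivity
  have hdist := hrange.norm_sub_le (Or.inl h0)
  simp only [mem_box, not_le, Nat.cast_mul] at h
  have hlow : (n : ℝ) * D < max ‖r‖ ‖s‖ := by
    rcases h with h | h
    · exact lt_max_of_lt_right h.2
    · exact lt_max_of_lt_left h.2
  have hup : max ‖r‖ ‖s‖ ≤ 2 * (n * D) := by
    have h1 := norm_sub_norm_le s r
    have h2 := norm_sub_norm_le r s
    rw [norm_sub_rev] at h1
    have h3 : (D : ℝ) ≤ n * D := by nlinarith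
    rcases h with h | h
    · exact max_le (by linarith [h.1]) (by linarith [h.1])
    · exact max_le (by linarith [h.1]) (by linarith [h.1])
  have hne : (r, s) ≠ (0, 0) := by
    intro h1
    rw [Prod.mk.injEq] at h1
    rw [h1.1, h1.2, norm_zero, max_self] at hlow
    linarith
  refine (hα r s hne).trans (mul_le_mul_of_nonneg_left ?_ hK)
  -- A crossing pair has $nD<\max(\|r\|,\|s\|)\le 2nD$. For $d=1$ the exponent $2-d$ is positive, so
  -- the upper bound is used and costs the factor $2=1+\delta_{1,d}$; for $d\ge2$ the lower bound
  -- suffices.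
  rcases Nat.eq_zero_or_pos e with rfl | he
  · have h1 : (2 : ℤ) - ((0 + 1 : ℕ) : ℤ) = 1 := by norm_num
    have h2 : (1 : ℤ) - ((0 : ℕ) : ℤ) = 1 := by norm_num
    rw [h1, h2, zpow_one, zpow_one, if_pos rfl]
    linarith
  · obtain ⟨f, rfl⟩ : ∃ f, e = f + 1 := ⟨e - 1, by omega⟩
    have h1 : (2 : ℤ) - ((f + 1 + 1 : ℕ) : ℤ) = -(f : ℤ) := by push_cast; ring
    have h2 : (1 : ℤ) - ((f + 1 : ℕ) : ℤ) = -(f : ℤ) := by push_cast; ring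
    rw [h1, h2, zpow_neg, zpow_neg, zpow_natCast, zpow_natCast]
    simp only [Nat.add_eq_right, Nat.add_eq_zero_iff, one_ne_zero, and_false, if_false, add_zero,
      one_mul]
    exact inv_anti₀ (by positivity) (pow_le_pow_left₀ hnD.le hlow.le f)

/-- The constant of the boundary estimate. -/
def boundaryConst (d D : ℕ) (K : ℝ) : ℝ :=
  8 * K * d * (1 + if d = 1 then 1 else 0) * (D : ℝ) ^ ((3 : ℤ) - (d : ℤ)) *
    (1 + 2 * (D : ℝ)) ^ (2 * d - 1)

lemma boundaryConst_nonneg (d D : ℕ) {K : ℝ} (hK : 0 ≤ K) : 0 ≤ boundaryConst d D K := by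
  unfold boundaryConst
  split_ifs <;> positivity

variable {d : ℕ} (lt : (Fin d → ℤ) → (Fin d → ℤ) → Prop) [IsStrictTotalOrder (Fin d → ℤ) lt]

lemma norm_finiteLindbladian_box_sub_le (hd : 1 ≤ d) {α : (Fin d → ℤ) → (Fin d → ℤ) → ℂ}
    (h : (Fin d → ℤ) → ℝ) {D : ℕ} (hD : 1 ≤ D) (hrange : HasRange α D) {K : ℝ} (hK : 0 ≤ K)
    (hα : GrowthBound α K) {n : ℕ} (hn : 1 ≤ n) {a : CAR lt}
    (ha : a ∈ localAlg lt (box d (n * D) : Set (Fin d → ℤ))) :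
    ‖finiteLindbladian lt α h (box d ((n + 1) * D)) a - finiteLindbladian lt α h (box d (n * D)) a‖
      ≤ boundaryConst d D K * n * ‖a‖ := by
  obtain ⟨e, rfl⟩ : ∃ e, d = e + 1 := ⟨d - 1, by omega⟩
  have hn' : (0 : ℝ) < n := by exact_mod_cast hn
  have hD' : (0 : ℝ) < D := by exact_mod_cast hD
  set c : ℝ := K * ((1 + if e + 1 = 1 then 1 else 0) * ((n : ℝ) * D) ^ (1 - (e : ℤ))) with hc
  have hc0 : 0 ≤ c := by
    rw [hc]
    split_ifs <;> positivity
  refine (norm_finiteLindbladian_sub_le lt α h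
    (box_subset_box (Nat.mul_le_mul_right D (Nat.le_succ n))) ha (boundaryPairs (e + 1) D n)
    (fun r hr s hs hrs => mem_boundaryPairs hn hr hs (hrange.norm_sub_le hrs))
    (fun r hr s hs => ⟨hα.sq_norm_le hK hrange hn hD (Or.inl ⟨hr, hs⟩),
      hα.sq_norm_le hK hrange hn hD (Or.inr ⟨hr, hs⟩)⟩) hc0).trans ?_
  refine mul_le_mul_of_nonneg_right ?_ (norm_nonneg a)
  refine (mul_le_mul_of_nonneg_left (card_boundaryPairs_le e D n hn)
    (by positivity)).trans (le_of_eq ?_)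
  -- Strength times surface: $(nD)^{2-d}\cdot Dn^{d-1}=D^{3-d}n$, linear in $n$ in every dimension.
  have h1 : ((n : ℝ) * D) ^ (1 - (e : ℤ)) * (D * n ^ e) =
      (D : ℝ) ^ ((3 : ℤ) - ((e + 1 : ℕ) : ℤ)) * n := by
    have h2 : (3 : ℤ) - ((e + 1 : ℕ) : ℤ) = (1 - (e : ℤ)) + 1 := by push_cast; ring
    have h3 : (n : ℝ) ^ (1 - (e : ℤ)) * n ^ e = n := by
      rw [← zpow_natCast (n : ℝ) e, ← zpow_add₀ hn'.ne']
      simp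
    rw [h2, zpow_add_one₀ hD'.ne', mul_zpow]
    linear_combination ((D : ℝ) ^ (1 - (e : ℤ)) * D) * h3
  rw [boundaryConst]
  generalize (1 + if e + 1 = 1 then (1 : ℝ) else 0) = w
  push_cast at h1 ⊢
  linear_combination (8 * K * (e + 1) * w * (1 + 2 * (D : ℝ)) ^ (2 * (e + 1) - 1)) * h1

/-- The local approximation of the Lindbladian by the finite Lindbladians of the cubes `R_n`. -/
def latticeApprox (hd : 1 ≤ d) {α : (Fin d → ℤ) → (Fin d → ℤ) → ℂ} (h : (Fin d → ℤ) → ℝ) {D : ℕ}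
    (hD : 1 ≤ D) (hrange : HasRange α D) {K : ℝ} (hK : 0 ≤ K) (hα : GrowthBound α K) :
    LocalApprox (CAR lt) where
  V n := (localAlg lt (box d (n * D) : Set (Fin d → ℤ))).toSubalgebra.toSubmodule
  A n := finiteLindbladian lt α h (box d (n * D))
  M := boundaryConst d D K
  mono m n hmn := localAlg_mono lt (Finset.coe_subset.2
    (box_subset_box (Nat.mul_le_mul_right D hmn)))
  dense x := by
    refine closure_mono ?_ (mem_closure_A₀ lt x)
    intro a ha
    obtain ⟨S, hS, haS⟩ := exists_finite_of_mem_A₀ lt ha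
    obtain ⟨m, hm⟩ := exists_subset_box hS
    exact Set.mem_iUnion.2 ⟨m, localAlg_mono lt
      (hm.trans (Finset.coe_subset.2 (box_subset_box (Nat.le_mul_of_pos_right m hD)))) haS⟩
  contraction n t ht := by
    obtain ⟨C, hC⟩ := norm_one_add_finiteLindbladian_le lt α h (box d (n * D))
    exact norm_expOp_le_one hC ht
  map_mem n a ha := finiteLindbladian_mem lt α h _ ha
  stable n m hnm a ha := by
    have ha0 : a ∈ A₀ lt := localAlg_mono lt (Set.subset_univ _) ha
    -- Sites interacting with $R_n$ lie in $R_{n+1}\subseteq R_k$, so every larger cube already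
    -- gives the full Lindbladian on $\mathcal A_{R_n}$.
    have key : ∀ k, n < k → lindbladian lt hrange.finiteValency h ⟨a, ha0⟩ =
        finiteLindbladian lt α h (box d (k * D)) a := fun k hk =>
      lindbladian_eq lt hrange.finiteValency h
        (box_subset_box (Nat.mul_le_mul_right D hk.le))
        (fun r hr => (hrange.interacting_subset n hr).trans
          (Finset.coe_subset.2 (box_subset_box (Nat.mul_le_mul_right D hk)))) ⟨a, ha0⟩ ha
    rw [← key m hnm, ← key (n + 1) (Nat.lt_succ_self n)]
  M_nonneg := boundaryConst_nonneg d D hK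
  norm_sub_le n hn a ha := norm_finiteLindbladian_box_sub_le lt hd h hD hrange hK hα hn ha

lemma lindbladian_box {α : (Fin d → ℤ) → (Fin d → ℤ) → ℂ} (h : (Fin d → ℤ) → ℝ) {D : ℕ}
    (hrange : HasRange α D) (n : ℕ) (a : (lindbladian lt hrange.finiteValency h).domain)
    (ha : (a : CAR lt) ∈ localAlg lt (box d (n * D) : Set (Fin d → ℤ))) :
    lindbladian lt hrange.finiteValency h a =
      finiteLindbladian lt α h (box d ((n + 1) * D)) a :=
  lindbladian_eq lt hrange.finiteValency h
    (box_subset_box (Nat.mul_le_mul_right D (Nat.le_succ n)))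
    (fun _ hr => hrange.interacting_subset n hr) a ha

/-- For $d\le2$ the exponent $2-d$ is nonnegative, and a nonzero lattice point has norm at least
$1$; so $K=C^2$ works. -/
lemma exists_growthBound {α : (Fin d → ℤ) → (Fin d → ℤ) → ℂ} (hd : 1 ≤ d) (hd2 : d ≤ 2) {C : ℝ}
    (hC : ∀ r s, ‖α r s‖ ≤ C) : ∃ K : ℝ, 0 ≤ K ∧ GrowthBound α K := by
  refine ⟨C ^ 2, sq_nonneg C, fun r s hrs => ?_⟩
  have h1 : ‖α r s‖ ^ 2 ≤ C ^ 2 := pow_le_pow_left₀ (norm_nonneg _) (hC r s) 2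
  have hnorm : ∀ u : Fin d → ℤ, u ≠ 0 → 1 ≤ ‖u‖ := by
    intro u hu
    by_contra! hc
    refine hu (funext fun i => ?_)
    have h2 := (norm_le_pi_norm u i).trans_lt hc
    rw [Int.norm_eq_abs] at h2
    have h3 : |u i| < 1 := by exact_mod_cast h2
    exact Int.abs_lt_one_iff.1 h3
  have hmax : 1 ≤ max ‖r‖ ‖s‖ := by
    by_cases hr : r = 0
    · have hs : s ≠ 0 := fun hs => hrs (by rw [hr, hs])
      exact (hnorm s hs).trans (le_max_right _ _)
    · exact (hnorm r hr).trans (le_max_left _ _)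
  refine h1.trans (le_mul_of_one_le_right (sq_nonneg C) ?_)
  exact one_le_zpow₀ hmax (by omega)

end Lattice

end QuantumExclusion
end

open QuantumExclusion
theorem mainTheorem6 (d : ℕ) (hd : 1 ≤ d)
    (lt : (Fin d → ℤ) → (Fin d → ℤ) → Prop) [IsStrictTotalOrder (Fin d → ℤ) lt]
    (α : (Fin d → ℤ) → (Fin d → ℤ) → ℂ) (h : (Fin d → ℤ) → ℝ)
    (D : ℕ) (hD : 1 ≤ D) (hrange : HasRange α D) :
    ∃ hα : FiniteValency α,
      (∀ K : ℝ, 0 ≤ K → GrowthBound α K →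
        (∃ T : C0Semigroup (CAR lt),
          (∀ t, ‖T.toFun t‖ ≤ 1) ∧ IsPregenerator T (lindbladian lt hα h)) ∧
        IsDissipative (lindbladian lt hα h) ∧
        (∀ n : ℕ, 1 ≤ n → ∀ a : (lindbladian lt hα h).domain,
          (a : CAR lt) ∈ localAlg lt (cube d D n) →
          truncLindbladian lt α h (cube d D n) a ∈ localAlg lt (cube d D n) ∧
          lindbladian lt hα h a ∈ localAlg lt (cube d D (n + 1)) ∧
          ‖lindbladian lt hα h a - truncLindbladian lt α h (cube d D n) a‖ ≤
            (8 * K * d * (1 + if d = 1 then 1 else 0) * (D : ℝ) ^ ((3 : ℤ) - (d : ℤ)) *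
              (1 + 2 * (D : ℝ)) ^ (2 * d - 1)) * n * ‖(a : CAR lt)‖)) ∧
      (d ≤ 2 → ∀ C : ℝ, (∀ r s, ‖α r s‖ ≤ C) → ∃ K : ℝ, 0 ≤ K ∧ GrowthBound α K) := by
  refine ⟨hrange.finiteValency, fun K hK hα => ?_, fun hd2 C hC => exists_growthBound hd hd2 hC⟩
  have hgen := (latticeApprox lt hd h hD hrange hK hα).exists_isPregenerator
    (L := lindbladian lt hrange.finiteValency h)
    (fun x hx => by
      obtain ⟨S, hS, haS⟩ := exists_finite_of_mem_A₀ lt hx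
      obtain ⟨m, hm⟩ := exists_subset_box hS
      exact ⟨m, localAlg_mono lt
        (hm.trans (Finset.coe_subset.2 (box_subset_box (Nat.le_mul_of_pos_right m hD)))) haS⟩)
    (fun n => localAlg_mono lt (Set.subset_univ _))
    (fun n x hx => lindbladian_box lt h hrange n x hx)
  refine ⟨hgen.1, hgen.2, fun n hn a ha => ?_⟩
  rw [← coe_box] at ha
  -- On $\mathcal A_{R_n}$ the truncated Lindbladian is $A_n$ and the full one is $A_{n+1}$, so the
  -- claims reduce to the finite cubes.
  rw [← coe_box, ← coe_box, truncLindbladian_eq lt α h _ a ha, lindbladian_box lt h hrange n a ha]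
  refine ⟨finiteLindbladian_mem lt α h _ ha, finiteLindbladian_mem lt α h _ ?_,
    norm_finiteLindbladian_box_sub_le lt hd h hD hrange hK hα hn ha⟩
  exact localAlg_mono lt (Finset.coe_subset.2
    (box_subset_box (Nat.mul_le_mul_right D (Nat.le_succ n)))) ha
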